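/- For integers $1\le h\le n$ let $K_n^h$ denote the graph on $n$ vertices obtained from the complete graph $K_h$ by attaching $n-h$ pendant edges at one and the same vertex of $K_h$. For a connected graph $G$ with vertices $v_1,\dots,v_n$, the distance matrix is $D(G)=(d_{ij})_{n\times n}$, where $d_{ij}$ is the distance between $v_i$ and $v_j$ in $G$, and the distance spectrum of $G$ is the multiset of eigenvalues of $D(G)$, counted with multiplicity. **Theorem.** Let $3\le h\le n-1$. Then $K_n^h$ is determined by its distance spectrum: every finite simple connected graph $G$ with the same distance spectrum as $K_n^h$ is isomorphic to $K_n^h$. -/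

import Mathlib

universe u v

namespace SimpleGraph

/-- The distance matrix `D(G) = (d_G(u, v))` of a graph on a finite vertex set, with real entries.
It is meant for connected graphs (`SimpleGraph.dist` is `0` between different components). -/
noncomputable def distanceMatrix {V : Type*} (G : SimpleGraph V) : Matrix V V ℝ :=
  Matrix.of fun u v => (G.dist u v : ℝ)

/-- The distance spectrum: the multiset of eigenvalues of `D(G)`, counted with multiplicity, that is
the roots of `det (λ I - D(G))`. All of them are real because `D(G)` is a real symmetric matrix. -/
noncomputable def distanceSpectrum {V : Type*} [Fintype V] [DecidableEq V]
    (G : SimpleGraph V) : Multiset ℝ :=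
  G.distanceMatrix.charpoly.roots

/-- A graph `G` is determined by its distance spectrum if every finite connected graph (with any
number of vertices) that has the same distance spectrum as `G` is isomorphic to `G`. -/
def IsDeterminedByDistanceSpectrum {V : Type u} [Fintype V] [DecidableEq V]
    (G : SimpleGraph V) : Prop :=
  ∀ (W : Type v) [Fintype W] [DecidableEq W] (H : SimpleGraph W),
    H.Connected → H.distanceSpectrum = G.distanceSpectrum → Nonempty (H ≃g G)

/-- The graph `K_n^h` for `1 ≤ h ≤ n`: the vertices `0, …, h - 1` form a complete graph `K_h`, and
each of the remaining `n - h` vertices `h, …, n - 1` is joined to the vertex `0` and to no other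
vertex. -/
def cliqueWithPendants (n h : ℕ) : SimpleGraph (Fin n) where
  Adj i j := i ≠ j ∧
    ((i.val < h ∧ j.val < h) ∨ (i.val = 0 ∧ h ≤ j.val) ∨ (j.val = 0 ∧ h ≤ i.val))
  symm := ⟨by
    rintro i j ⟨hne, hij⟩
    exact ⟨hne.symm, by tauto⟩⟩
  loopless := ⟨fun _ hi => hi.1 rfl⟩

end SimpleGraph

/-! Put a = h - 1 and b = n - h, so that K_n^h = K_1 ∨ (K_a ∪ b K_1). Its distance eigenvalues are
-1 (a - 1 times), -2 (b - 1 times) and the roots r₁ > 0, -1 < r₂ < 0, r₃ < -2 of a cubic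
(`roots_charpoly_pendant`). Hence for a cospectral G with distance matrix D, the form of D + I has
at most two positive directions, that of D + 2I at most one negative direction, D is negative
definite on a hyperplane, and (D + I)(D + 2I) has rank at most 3 (`HasPendantInertia`).

These facts are applied to a few vertices at prescribed mutual distances. Such a configuration may
violate the inertia, and is then forbidden. Or it exhausts the inertia; then an isotropic difference
e_u - e_x lies in the kernel of D + I or D + 2I, which makes u and x twins in all of G. A
maximum-degree argument shows that G has a universal vertex or a geodesic path on four vertices
(`exists_isUniversalVertex_or_isGeodesicFour`).

If there is such a path, every other vertex is a twin of one of its vertices, so D is a blow-up of a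
4 × 4 pattern (`exists_pathDist_blocks`); the rank bound, the multiplicity of -1 and the trace of D²
exclude this (`blockMatrix_pathDist_false`). If there is a universal vertex, the non-universal
vertices form disjoint cliques and G is K_s ∨ (K_p ∪ q K_1) or K_s ∨ (K_p ∪ K_q)
(`IsUniversalVertex.exists_blocks`). Multiplicities, the trace of D² and, in the second case, the
root r₁ then fix the class sizes. -/

/-! ### Block matrices, their quotients and eigenvalue multiplicities -/

/-- The matrix with zero diagonal whose entry at `(x, y)`, `x ≠ y`, depends only on the classes
`κ x` and `κ y`. -/
def blockMatrix {W ι : Type*} [DecidableEq W] (κ : W → ι) (m : ι → ι → ℝ) : Matrix W W ℝ :=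
  Matrix.of fun x y => if x = y then 0 else m (κ x) (κ y)

/-- The size of a class. -/
def classSize {W ι : Type*} [Fintype W] [DecidableEq ι] (κ : W → ι) (c : ι) : ℕ := Fintype.card {x // κ x = c}

lemma sum_classSize_mul {W ι : Type*} [Fintype W] [Fintype ι] [DecidableEq ι]
    (κ : W → ι) (F : ι → ℝ) : ∑ x, F (κ x) = ∑ c, (classSize κ c : ℝ) * F c := by
  rw [← Finset.sum_fiberwise Finset.univ κ]
  refine Finset.sum_congr rfl fun c _ => ?_
  rw [Finset.sum_congr rfl (g := fun _ => F c), Finset.sum_const, nsmul_eq_mul, classSize,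
    Fintype.card_subtype]
  intro x hx
  rw [(Finset.mem_filter.mp hx).2]

lemma sum_class_comp {W ι : Type*} [Fintype W] [DecidableEq ι] (κ : W → ι)
    (g : ι → ℝ) (c : ι) :
    ∑ y with κ y = c, g (κ y) = classSize κ c * g c := by
  rw [Finset.sum_congr rfl (g := fun _ => g c), Finset.sum_const, nsmul_eq_mul, classSize,
    Fintype.card_subtype]
  intro x hx
  rw [(Finset.mem_filter.mp hx).2]

section Block

variable {W ι : Type*} [Fintype W] [DecidableEq W] [Fintype ι] [DecidableEq ι]
  (κ : W → ι) (m : ι → ι → ℝ)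

lemma blockMatrix_mulVec (f : W → ℝ) (x : W) :
    (blockMatrix κ m).mulVec f x =
      (∑ c, m (κ x) c * ∑ y with κ y = c, f y) - m (κ x) (κ x) * f x := by
  have h1 : ∑ c, m (κ x) c * ∑ y with κ y = c, f y = ∑ y, m (κ x) (κ y) * f y := by
    rw [← Finset.sum_fiberwise Finset.univ κ]
    refine Finset.sum_congr rfl fun c _ => ?_
    rw [Finset.mul_sum]
    refine Finset.sum_congr rfl fun y hy => ?_
    rw [(Finset.mem_filter.mp hy).2]
  rw [h1, Matrix.mulVec, dotProduct, ← Finset.sum_erase_add _ _ (Finset.mem_univ x),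
    ← Finset.sum_erase_add (a := x) (f := fun y => m (κ x) (κ y) * f y) _ (Finset.mem_univ x)]
  simp only [blockMatrix, Matrix.of_apply, if_true, zero_mul, add_zero, add_sub_cancel_right]
  refine Finset.sum_congr rfl fun y hy => ?_
  rw [if_neg (Finset.ne_of_mem_erase hy).symm]

/-- The quotient matrix of a block matrix. -/
def quotientMatrix : Matrix ι ι ℝ :=
  Matrix.of fun c d => m c d * classSize κ d - if c = d then m c c else 0

lemma blockMatrix_mulVec_comp (g : ι → ℝ) :
    (blockMatrix κ m).mulVec (g ∘ κ) = (quotientMatrix κ m).mulVec g ∘ κ := by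
  funext x
  rw [blockMatrix_mulVec]
  simp only [Function.comp_apply, sum_class_comp, Matrix.mulVec, dotProduct, quotientMatrix,
    Matrix.of_apply, sub_mul, Finset.sum_sub_distrib, ite_mul, zero_mul, Finset.sum_ite_eq,
    Finset.mem_univ, if_true, mul_assoc]

lemma sum_sq_blockMatrix :
    ∑ x, ∑ y, blockMatrix κ m x y ^ 2 =
      (∑ c, ∑ d, (classSize κ c : ℝ) * classSize κ d * m c d ^ 2)
        - ∑ c, (classSize κ c : ℝ) * m c c ^ 2 := by
  have h1 : ∀ x, ∑ y, blockMatrix κ m x y ^ 2 =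
      (∑ d, (classSize κ d : ℝ) * m (κ x) d ^ 2) - m (κ x) (κ x) ^ 2 := by
    intro x
    rw [← sum_classSize_mul κ (fun d => m (κ x) d ^ 2),
      ← Finset.sum_erase_add _ _ (Finset.mem_univ x),
      ← Finset.sum_erase_add (a := x) (f := fun y => m (κ x) (κ y) ^ 2) _ (Finset.mem_univ x),
      add_sub_cancel_right]
    simp only [blockMatrix, Matrix.of_apply, if_true]
    rw [zero_pow two_ne_zero, add_zero]
    refine Finset.sum_congr rfl fun y hy => ?_
    rw [if_neg (Finset.ne_of_mem_erase hy).symm]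
  rw [Finset.sum_congr rfl fun x _ => h1 x, Finset.sum_sub_distrib,
    sum_classSize_mul κ fun c => ∑ d, (classSize κ d : ℝ) * m c d ^ 2,
    sum_classSize_mul κ fun c => m c c ^ 2]
  congr 1
  refine Finset.sum_congr rfl fun c _ => ?_
  rw [Finset.mul_sum]
  exact Finset.sum_congr rfl fun d _ => by ring

lemma finrank_eigenspace_le_count (D : Matrix W W ℝ) (r : ℝ) :
    Module.finrank ℝ (Module.End.eigenspace (Matrix.toLin' D) r) ≤ D.charpoly.roots.count r := by
  rw [Polynomial.count_roots]
  simpa using LinearMap.finrank_eigenspace_le (Matrix.toLin' D) r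

lemma one_le_count_of_mulVec_eq {D : Matrix W W ℝ} {r : ℝ} {f : W → ℝ} (hf : f ≠ 0)
    (h : D.mulVec f = r • f) : 1 ≤ D.charpoly.roots.count r := by
  rw [Multiset.one_le_count_iff_mem, Polynomial.mem_roots (Matrix.charpoly_monic D).ne_zero]
  have h1 : Module.End.HasEigenvalue (Matrix.toLin' D) r :=
    Module.End.hasEigenvalue_of_hasEigenvector
      ⟨Module.End.mem_eigenspace_iff.mpr
      (by rw [Matrix.toLin'_apply, h]), hf⟩
  simpa using (Module.End.hasEigenvalue_iff_isRoot_charpoly _ _).mp h1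

/-- An eigenvector of the quotient, pulled back along `κ`, is an eigenvector of the block matrix;
surjectivity keeps it nonzero. -/
lemma one_le_count_of_quotientMatrix (hκ : Function.Surjective κ) {r : ℝ}
    (h : (quotientMatrix κ m - r • (1 : Matrix ι ι ℝ)).det = 0) :
    1 ≤ (blockMatrix κ m).charpoly.roots.count r := by
  obtain ⟨g, hg, hr⟩ := Matrix.exists_mulVec_eq_zero_iff.mpr h
  refine one_le_count_of_mulVec_eq (f := g ∘ κ) ?_ ?_
  · intro h0
    apply hg
    funext c
    obtain ⟨x, rfl⟩ := hκ c
    exact congrFun h0 x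
  · rw [blockMatrix_mulVec_comp]
    rw [Matrix.sub_mulVec, sub_eq_zero, Matrix.smul_mulVec, Matrix.one_mulVec] at hr
    rw [hr]
    rfl

/-- A function that lives on the classes with diagonal value `μ` and sums to zero on each of them is
an eigenvector for `-μ`. These functions form the kernel of `T`, and one dimension is lost per
class. -/
lemma card_le_count_blockMatrix (μ : ℝ) :
    Fintype.card {x // m (κ x) (κ x) = μ} ≤
      (blockMatrix κ m).charpoly.roots.count (-μ) + Fintype.card {c // m c c = μ} := by
  classical
  let T : (W → ℝ) →ₗ[ℝ] ({x // ¬ m (κ x) (κ x) = μ} → ℝ) × ({c // m c c = μ} → ℝ) :=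
    LinearMap.prod (LinearMap.pi fun x => LinearMap.proj x.1)
      (LinearMap.pi fun c => ∑ y with κ y = c.1, LinearMap.proj y)
  have hker : LinearMap.ker T ≤ Module.End.eigenspace (Matrix.toLin' (blockMatrix κ m)) (-μ) := by
    intro f hf
    have h1 : ∀ x, ¬ m (κ x) (κ x) = μ → f x = 0 := fun x hx =>
      congrFun (congrArg Prod.fst hf) ⟨x, hx⟩
    have h2 : ∀ c, m c c = μ → ∑ y with κ y = c, f y = 0 := fun c hc => by
      simpa [T] using congrFun (congrArg Prod.snd hf) ⟨c, hc⟩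
    have h3 : ∀ c, ∑ y with κ y = c, f y = 0 := fun c => by
      by_cases hc : m c c = μ
      · exact h2 c hc
      · refine Finset.sum_eq_zero fun y hy => h1 y ?_
        rwa [(Finset.mem_filter.mp hy).2]
    rw [Module.End.mem_eigenspace_iff, Matrix.toLin'_apply]
    funext x
    rw [blockMatrix_mulVec]
    simp only [h3, mul_zero, Finset.sum_const_zero, zero_sub, Pi.smul_apply, smul_eq_mul, neg_mul]
    by_cases hx : m (κ x) (κ x) = μ
    · rw [hx]
    · rw [h1 x hx, mul_zero, mul_zero]
  have h4 := (Submodule.finrank_mono hker).trans (finrank_eigenspace_le_count _ _)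
  have h5 := T.finrank_range_add_finrank_ker
  have h6 := (LinearMap.range T).finrank_le
  have h7 := Fintype.card_subtype_compl fun x => m (κ x) (κ x) = μ
  have h8 := Fintype.card_subtype_le fun x => m (κ x) (κ x) = μ
  simp only [Module.finrank_prod, Module.finrank_fintype_fun_eq_card] at h5 h6
  omega

end Block

lemma card_subtype_comp {W ι : Type*} [Fintype W] [Fintype ι] [DecidableEq ι] (κ : W → ι)
    (p : ι → Prop) [DecidablePred p] :
    Fintype.card {x // p (κ x)} = ∑ c with p c, classSize κ c := by
  rw [Fintype.card_subtype, Finset.card_eq_sum_card_fiberwise (f := κ) (t := {c | p c})]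
  · refine Finset.sum_congr rfl fun c hc => ?_
    rw [classSize, Fintype.card_subtype, Finset.filter_filter]
    congr 1
    ext x
    simp only [Finset.mem_filter, Finset.mem_univ, true_and] at hc ⊢
    exact ⟨fun h => h.2, fun h => ⟨h ▸ hc, h⟩⟩
  · intro x hx
    simpa using hx

lemma card_eq_sum_classSize {W ι : Type*} [Fintype W] [Fintype ι] [DecidableEq ι] (κ : W → ι) :
    Fintype.card W = ∑ c, classSize κ c := by
  have h := card_subtype_comp κ fun _ => True
  simp only [Finset.filter_true] at h
  rw [← h]
  exact (Fintype.card_congr (Equiv.subtypeUnivEquiv fun _ => trivial)).symm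

lemma sum_classSize_le_count {W ι : Type*} [Fintype W] [DecidableEq W] [Fintype ι] [DecidableEq ι]
    (κ : W → ι) (m : ι → ι → ℝ) (μ : ℝ) (s : Finset ι) (hs : ∀ c, c ∈ s ↔ m c c = μ) :
    ∑ c ∈ s, classSize κ c ≤ (blockMatrix κ m).charpoly.roots.count (-μ) + s.card := by
  classical
  have h1 := card_le_count_blockMatrix κ m μ
  rw [card_subtype_comp κ fun c => m c c = μ, Fintype.card_subtype] at h1
  have h2 : ({c | m c c = μ} : Finset ι) = s := by
    ext c
    simp [hs]
  rwa [h2] at h1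

/-! ### The spectrum of K_1 ∨ (K_a ∪ b K_1) -/

/-- Distances between the classes of `K_s ∨ (K_p ∪ q K_1)`. -/
def splitDist : Fin 3 → Fin 3 → ℝ := ![![1, 1, 1], ![1, 1, 2], ![1, 2, 2]]

/-- Distances between the classes of `K_s ∨ (K_p ∪ K_q)`. -/
def twoCliqueDist : Fin 3 → Fin 3 → ℝ := ![![1, 1, 1], ![1, 1, 2], ![1, 2, 1]]

/-- The characteristic polynomial of the quotient matrix of `K_1 ∨ (K_a ∪ b K_1)`. -/
def pendantCubic (a b x : ℝ) : ℝ :=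
  x * ((x - a + 1) * (x - 2 * b + 2) - 4 * a * b) - a * (x + 2) - b * (x + a + 1)

lemma det_quotientMatrix_splitDist {W : Type*} [Fintype W] (κ : W → Fin 3)
    (h0 : classSize κ 0 = 1) (r : ℝ) :
    (quotientMatrix κ splitDist - r • (1 : Matrix (Fin 3) (Fin 3) ℝ)).det =
      - pendantCubic (classSize κ 1) (classSize κ 2) r := by
  rw [Matrix.det_fin_three]
  simp [quotientMatrix, splitDist, h0, pendantCubic]
  ring

/-- Sign changes: the cubic is negative at 0, equals ab at -1 and 3b(a - 1) at -2, and ±(2a + 4b)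
lies beyond all roots. -/
lemma exists_roots_pendantCubic {a b : ℝ} (ha : 2 ≤ a) (hb : 1 ≤ b) :
    ∃ r₁ r₂ r₃ : ℝ, 0 < r₁ ∧ -1 < r₂ ∧ r₂ < 0 ∧ r₃ < -2 ∧
      pendantCubic a b r₁ = 0 ∧ pendantCubic a b r₂ = 0 ∧ pendantCubic a b r₃ = 0 := by
  have hc : Continuous (pendantCubic a b) := by
    unfold pendantCubic
    fun_prop
  -- After the shift to nonnegative variables, the values at the two far points expand with
  -- coefficients of one sign.
  obtain ⟨a, rfl⟩ : ∃ t, a = 2 + t := ⟨a - 2, by ring⟩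
  obtain ⟨b, rfl⟩ : ∃ t, b = 1 + t := ⟨b - 1, by ring⟩
  have ha' : 0 ≤ a := by linarith
  have hb' : 0 ≤ b := by linarith
  have hab : 0 ≤ a * b := mul_nonneg ha' hb'
  have p0 : pendantCubic (2 + a) (1 + b) 0 < 0 := by
    unfold pendantCubic; nlinarith
  have p1 : 0 < pendantCubic (2 + a) (1 + b) (-1) := by
    unfold pendantCubic; nlinarith
  have p2 : 0 < pendantCubic (2 + a) (1 + b) (-2) := by
    unfold pendantCubic; nlinarith
  have p3 : 0 < pendantCubic (2 + a) (1 + b) (2 * (2 + a) + 4 * (1 + b)) := by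
    unfold pendantCubic; ring_nf; positivity
  have p4 : pendantCubic (2 + a) (1 + b) (-(2 * (2 + a) + 4 * (1 + b))) < 0 := by
    rw [← neg_pos]; unfold pendantCubic; ring_nf; positivity
  obtain ⟨r₁, h₁, e₁⟩ := intermediate_value_Ioo (by linarith) hc.continuousOn
    (show (0 : ℝ) ∈ Set.Ioo _ _ from ⟨p0, p3⟩)
  obtain ⟨r₂, h₂, e₂⟩ := intermediate_value_Ioo' (by norm_num) hc.continuousOn
    (show (0 : ℝ) ∈ Set.Ioo _ _ from ⟨p0, p1⟩)
  obtain ⟨r₃, h₃, e₃⟩ := intermediate_value_Ioo (by linarith) hc.continuousOn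
    (show (0 : ℝ) ∈ Set.Ioo _ _ from ⟨p4, p2⟩)
  exact ⟨r₁, r₂, r₃, h₁.1, h₂.1, h₂.2, h₃.2, e₁, e₂, e₃⟩

section Split

variable {W : Type*} [Fintype W] [DecidableEq W] (κ : W → Fin 3)

lemma splitDist_count_neg_one :
    classSize κ 0 + classSize κ 1 ≤
      (blockMatrix κ splitDist).charpoly.roots.count (-1) + 2 := by
  have h := sum_classSize_le_count κ splitDist 1 {0, 1} (by
    intro c; fin_cases c <;> simp [splitDist])
  simpa using h

lemma splitDist_count_neg_two :
    classSize κ 2 ≤ (blockMatrix κ splitDist).charpoly.roots.count (-2) + 1 := by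
  have h := sum_classSize_le_count κ splitDist 2 {2} (by
    intro c; fin_cases c <;> simp [splitDist])
  simpa using h

lemma twoCliqueDist_count_neg_one :
    classSize κ 0 + classSize κ 1 + classSize κ 2 ≤
      (blockMatrix κ twoCliqueDist).charpoly.roots.count (-1) + 3 := by
  have h := sum_classSize_le_count κ twoCliqueDist 1 Finset.univ (by
    intro c; fin_cases c <;> simp [twoCliqueDist])
  simpa [Fin.sum_univ_three] using h

lemma sum_sq_splitDist :
    ∑ x, ∑ y, blockMatrix κ splitDist x y ^ 2 =
      ((classSize κ 0 : ℝ) + classSize κ 1 + classSize κ 2) ^ 2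
        - (classSize κ 0 + classSize κ 1 + classSize κ 2)
        + 3 * (2 * classSize κ 1 * classSize κ 2 + classSize κ 2 ^ 2 - classSize κ 2) := by
  rw [sum_sq_blockMatrix]
  simp [Fin.sum_univ_three, splitDist]
  ring

lemma sum_sq_twoCliqueDist :
    ∑ x, ∑ y, blockMatrix κ twoCliqueDist x y ^ 2 =
      ((classSize κ 0 : ℝ) + classSize κ 1 + classSize κ 2) ^ 2
        - (classSize κ 0 + classSize κ 1 + classSize κ 2)
        + 3 * (2 * classSize κ 1 * classSize κ 2) := by
  rw [sum_sq_blockMatrix]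
  simp [Fin.sum_univ_three, twoCliqueDist]
  ring

/-- The three cubic roots and the lower bounds a - 1 and b - 1 for the multiplicities of -1 and -2
already account for all a + b + 1 roots. -/
lemma roots_charpoly_pendant {a b : ℕ} (ha : 2 ≤ a) (hb : 1 ≤ b) (h0 : classSize κ 0 = 1)
    (h1 : classSize κ 1 = a) (h2 : classSize κ 2 = b) :
    ∃ r₁ r₂ r₃ : ℝ, 0 < r₁ ∧ -1 < r₂ ∧ r₂ < 0 ∧ r₃ < -2 ∧ pendantCubic a b r₁ = 0 ∧
      (blockMatrix κ splitDist).charpoly.roots =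
        {r₁, r₂, r₃} + Multiset.replicate (a - 1) (-1) + Multiset.replicate (b - 1) (-2) := by
  obtain ⟨r₁, r₂, r₃, q₁, q₂, q₂', q₃, e₁, e₂, e₃⟩ :=
    exists_roots_pendantCubic (a := a) (b := b) (by exact_mod_cast ha) (by exact_mod_cast hb)
  refine ⟨r₁, r₂, r₃, q₁, q₂, q₂', q₃, e₁, ?_⟩
  have hκ : Function.Surjective κ := by
    intro c
    have hc : 0 < classSize κ c := by fin_cases c <;> simp <;> omega
    obtain ⟨x, hx⟩ := Fintype.card_pos_iff.mp hc
    exact ⟨x, hx⟩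
  have key : ∀ r, pendantCubic a b r = 0 →
      1 ≤ (blockMatrix κ splitDist).charpoly.roots.count r := by
    intro r hr
    refine one_le_count_of_quotientMatrix κ _ hκ ?_
    rw [det_quotientMatrix_splitDist κ h0, h1, h2, hr, neg_zero]
  have c₁ := key _ e₁
  have c₂ := key _ e₂
  have c₃ := key _ e₃
  have c₄ := splitDist_count_neg_one κ
  have c₅ := splitDist_count_neg_two κ
  have hcard := card_eq_sum_classSize κ
  rw [Fin.sum_univ_three, h0, h1, h2] at hcard
  symm
  apply Multiset.eq_of_le_of_card_le
  · rw [Multiset.le_iff_count]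
    intro x
    simp only [Multiset.count_add, Multiset.count_replicate, Multiset.insert_eq_cons,
      Multiset.count_cons, Multiset.count_singleton]
    by_cases x₁ : x = r₁
    · subst x₁
      simpa [show x ≠ r₂ by linarith, show x ≠ r₃ by linarith,
        show -1 ≠ x by linarith, show -2 ≠ x by linarith] using c₁
    by_cases x₂ : x = r₂
    · subst x₂
      simpa [x₁, show x ≠ r₃ by linarith,
        show -1 ≠ x by linarith, show -2 ≠ x by linarith] using c₂
    by_cases x₃ : x = r₃
    · subst x₃
      simpa [x₁, x₂, show -1 ≠ x by linarith, show -2 ≠ x by linarith] using c₃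
    by_cases x₄ : -1 = x
    · subst x₄
      simp [x₁, x₂, x₃, -Polynomial.count_roots]
      omega
    by_cases x₅ : -2 = x
    · subst x₅
      simp [x₁, x₂, x₃, -Polynomial.count_roots]
      omega
    simp [x₁, x₂, x₃, x₄, x₅]
  · refine (Polynomial.card_roots' _).trans ?_
    rw [Matrix.charpoly_natDegree_eq_dim, hcard]
    simp
    omega

end Split

/-! ### From the spectrum to the inertia of shifted distance matrices -/

section Spectral

variable {W : Type*} [Fintype W] [DecidableEq W]

/-- The spectral information on a distance matrix that is used to find forbidden submatrices. -/
structure HasPendantInertia (D : Matrix W W ℝ) : Prop where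
  isSymm : D.IsSymm
  one : ∃ c₁ c₂ : (W → ℝ) →ₗ[ℝ] ℝ, ∀ x, c₁ x = 0 → c₂ x = 0 →
    Matrix.toBilin' (D + (1 : ℝ) • 1) x x ≤ 0
  two : ∃ c : (W → ℝ) →ₗ[ℝ] ℝ, ∀ x, c x = 0 → 0 ≤ Matrix.toBilin' (D + (2 : ℝ) • 1) x x
  zero : ∃ c : (W → ℝ) →ₗ[ℝ] ℝ, ∀ x, x ≠ 0 → c x = 0 →
    Matrix.toBilin' (D + (0 : ℝ) • 1) x x < 0
  rank : ∃ c₁ c₂ c₃ : (W → ℝ) →ₗ[ℝ] ℝ, ∀ x, c₁ x = 0 → c₂ x = 0 → c₃ x = 0 →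
    (D + (1 : ℝ) • 1).mulVec ((D + (2 : ℝ) • 1).mulVec x) = 0

lemma exists_orthogonal_diagonalization {D : Matrix W W ℝ} (hD : D.IsSymm) :
    ∃ (U : Matrix W W ℝ) (l : W → ℝ), U.transpose * U = 1 ∧ U * U.transpose = 1 ∧
      D = U * Matrix.diagonal l * U.transpose ∧
      D.charpoly.roots = Multiset.map l Finset.univ.val := by
  have hH : D.IsHermitian := by
    rw [Matrix.IsHermitian, Matrix.conjTranspose_eq_transpose_of_trivial]
    exact hD
  refine ⟨hH.eigenvectorUnitary, hH.eigenvalues, ?_, ?_, ?_, ?_⟩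
  · have := Unitary.coe_star_mul_self hH.eigenvectorUnitary
    rwa [Matrix.star_eq_conjTranspose, Matrix.conjTranspose_eq_transpose_of_trivial] at this
  · have := Unitary.coe_mul_star_self hH.eigenvectorUnitary
    rwa [Unitary.coe_star, Matrix.star_eq_conjTranspose, Matrix.conjTranspose_eq_transpose_of_trivial] at this
  · have := hH.spectral_theorem
    rw [Unitary.conjStarAlgAut_apply, Matrix.star_eq_conjTranspose,
      Matrix.conjTranspose_eq_transpose_of_trivial] at this
    exact this
  · simpa using hH.roots_charpoly_eq_eigenvalues

lemma sum_sq_eq_sum_roots {D : Matrix W W ℝ} (hD : D.IsSymm) :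
    ∑ x, ∑ y, D x y ^ 2 = (D.charpoly.roots.map fun r => r ^ 2).sum := by
  obtain ⟨U, l, h1, -, h3, h4⟩ := exists_orthogonal_diagonalization hD
  have h5 : ∑ x, ∑ y, D x y ^ 2 = (D * D).trace := by
    simp only [Matrix.trace, Matrix.diag, Matrix.mul_apply]
    refine Finset.sum_congr rfl fun x _ => Finset.sum_congr rfl fun y _ => ?_
    rw [hD.apply x y, sq]
  have h6 : D * D = U * (Matrix.diagonal l * Matrix.diagonal l * U.transpose) := by
    rw [h3]
    simp only [Matrix.mul_assoc]
    rw [← Matrix.mul_assoc U.transpose U, h1, Matrix.one_mul]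
  rw [h5, h6, Matrix.trace_mul_comm, Matrix.mul_assoc, h1, Matrix.mul_one,
    Matrix.diagonal_mul_diagonal, Matrix.trace_diagonal, h4, Multiset.map_map]
  exact Finset.sum_congr rfl fun i _ => (sq _).symm

/-- The functionals are the coordinates along the eigenvectors of r₁, r₂, r₃. Where the relevant
ones vanish, the remaining eigenvalues of D + I, D + 2I and D have a constant sign, and (D + I)(D +
2I) kills what is left. -/
lemma hasPendantInertia_of_roots {D : Matrix W W ℝ} (hD : D.IsSymm) {r₁ r₂ r₃ : ℝ} {j k : ℕ}
    (h₁ : 0 < r₁) (h₂ : -1 < r₂) (h₂' : r₂ < 0) (h₃ : r₃ < -2)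
    (h : D.charpoly.roots =
      {r₁, r₂, r₃} + Multiset.replicate j (-1) + Multiset.replicate k (-2)) :
    HasPendantInertia D := by
  obtain ⟨U, l, hU, hU', hDU, hl⟩ := exists_orthogonal_diagonalization hD
  rw [h] at hl
  have hcount : ∀ r, (Multiset.count r ({r₁, r₂, r₃} + Multiset.replicate j (-1) +
      Multiset.replicate k (-2))) = (Finset.univ.filter fun i => r = l i).card := by
    intro r
    rw [hl, Multiset.count_map]
    rfl
  have huniq : ∀ r, r ≠ -1 → r ≠ -2 → (r = r₁ ∨ r = r₂ ∨ r = r₃) → ∃ i, ∀ i', l i' = r ↔ i' = i := by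
    intro r n₁ n₂ hr
    have hc : (Finset.univ.filter fun i => r = l i).card = 1 := by
      rw [← hcount]
      simp only [Multiset.count_add, Multiset.count_replicate, Multiset.insert_eq_cons,
        Multiset.count_cons, Multiset.count_singleton, if_neg n₁.symm, if_neg n₂.symm]
      rcases hr with rfl | rfl | rfl
      · simp [show r ≠ r₂ by linarith, show r ≠ r₃ by linarith]
      · simp [show r ≠ r₁ by linarith, show r ≠ r₃ by linarith]
      · simp [show r ≠ r₁ by linarith, show r ≠ r₂ by linarith]
    obtain ⟨i, hi⟩ := Finset.card_eq_one.mp hc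
    refine ⟨i, fun i' => ?_⟩
    have := Finset.ext_iff.mp hi i'
    simp only [Finset.mem_filter, Finset.mem_univ, true_and, Finset.mem_singleton] at this
    rw [← this, eq_comm]
  obtain ⟨i₁, hi₁⟩ := huniq r₁ (by linarith) (by linarith) (by simp)
  obtain ⟨i₂, hi₂⟩ := huniq r₂ (by linarith) (by linarith) (by simp)
  obtain ⟨i₃, hi₃⟩ := huniq r₃ (by linarith) (by linarith) (by simp)
  have e₁ := (hi₁ i₁).mpr rfl
  have e₂ := (hi₂ i₂).mpr rfl
  have e₃ := (hi₃ i₃).mpr rfl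
  have hrest : ∀ i, i = i₁ ∨ i = i₂ ∨ i = i₃ ∨ l i = -1 ∨ l i = -2 := by
    intro i
    have hm : l i ∈ ({r₁, r₂, r₃} + Multiset.replicate j (-1) +
        Multiset.replicate k (-2) : Multiset ℝ) := by
      rw [hl]
      exact Multiset.mem_map_of_mem l (Finset.mem_univ i)
    simp only [Multiset.mem_add, Multiset.insert_eq_cons, Multiset.mem_cons,
      Multiset.mem_singleton, Multiset.mem_replicate, hi₁, hi₂, hi₃] at hm
    tauto
  have hsh : ∀ t : ℝ, D + t • 1 = U * Matrix.diagonal (fun i => l i + t) * U.transpose := by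
    intro t
    have : Matrix.diagonal (fun i => l i + t) = Matrix.diagonal l + t • 1 := by
      ext i i'
      by_cases hii : i = i' <;> simp [hii]
    rw [this, Matrix.mul_add, Matrix.add_mul, ← hDU, Matrix.mul_smul, Matrix.mul_one,
      Matrix.smul_mul, hU']
  have hform : ∀ (t : ℝ) (x : W → ℝ), Matrix.toBilin' (D + t • 1) x x =
      ∑ i, (l i + t) * (U.transpose.mulVec x i) ^ 2 := by
    intro t x
    rw [Matrix.toBilin'_apply', hsh, ← Matrix.mulVec_mulVec, ← Matrix.mulVec_mulVec,
      Matrix.dotProduct_mulVec, ← Matrix.mulVec_transpose]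
    simp only [dotProduct, Matrix.mulVec_diagonal]
    exact Finset.sum_congr rfl fun i _ => by ring
  let C : W → (W → ℝ) →ₗ[ℝ] ℝ := fun i => LinearMap.proj i ∘ₗ U.transpose.mulVecLin
  have hC : ∀ i x, C i x = U.transpose.mulVec x i := fun i x => rfl
  refine ⟨hD, ⟨C i₁, C i₂, ?_⟩, ⟨C i₃, ?_⟩, ⟨C i₁, ?_⟩, ⟨C i₁, C i₂, C i₃, ?_⟩⟩
  · intro x x₁ x₂
    rw [hC] at x₁ x₂
    rw [hform]
    refine Finset.sum_nonpos fun i _ => ?_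
    rcases hrest i with rfl | rfl | rfl | hi | hi
    · simp [x₁]
    · simp [x₂]
    · rw [e₃]
      exact mul_nonpos_of_nonpos_of_nonneg (by linarith) (sq_nonneg _)
    all_goals rw [hi]
    · simp
    · nlinarith [sq_nonneg (U.transpose.mulVec x i)]
  · intro x x₃
    rw [hC] at x₃
    rw [hform]
    refine Finset.sum_nonneg fun i _ => ?_
    rcases hrest i with rfl | rfl | rfl | hi | hi
    · rw [e₁]; exact mul_nonneg (by linarith) (sq_nonneg _)
    · rw [e₂]; exact mul_nonneg (by linarith) (sq_nonneg _)
    · simp [x₃]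
    all_goals rw [hi]
    · nlinarith [sq_nonneg (U.transpose.mulVec x i)]
    · simp
  · intro x hx x₁
    rw [hC] at x₁
    rw [hform]
    obtain ⟨i₀, hi₀⟩ : ∃ i, U.transpose.mulVec x i ≠ 0 := by
      by_contra hcon
      push Not at hcon
      apply hx
      have : U.mulVec (U.transpose.mulVec x) = 0 := by
        rw [show U.transpose.mulVec x = 0 from funext hcon, Matrix.mulVec_zero]
      rwa [Matrix.mulVec_mulVec, hU', Matrix.one_mulVec] at this
    have hneg : ∀ i, i ≠ i₁ → l i + 0 < 0 := by
      intro i hi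
      rcases hrest i with h' | rfl | rfl | h' | h'
      · exact absurd h' hi
      all_goals linarith
    refine Finset.sum_neg' (fun i _ => ?_) ⟨i₀, Finset.mem_univ _, ?_⟩
    · by_cases hi : i = i₁
      · subst hi; simp [x₁]
      · exact mul_nonpos_of_nonpos_of_nonneg (hneg i hi).le (sq_nonneg _)
    · refine mul_neg_of_neg_of_pos (hneg i₀ ?_) (by positivity)
      rintro rfl
      exact hi₀ x₁
  · intro x x₁ x₂ x₃
    rw [hC] at x₁ x₂ x₃
    rw [hsh, hsh, Matrix.mulVec_mulVec]
    have hm : U * Matrix.diagonal (fun i => l i + 1) * U.transpose *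
        (U * Matrix.diagonal (fun i => l i + 2) * U.transpose) =
        U * Matrix.diagonal (fun i => (l i + 1) * (l i + 2)) * U.transpose := by
      simp only [Matrix.mul_assoc]
      rw [← Matrix.mul_assoc U.transpose U, hU, Matrix.one_mul,
        ← Matrix.mul_assoc (Matrix.diagonal _) (Matrix.diagonal _), Matrix.diagonal_mul_diagonal]
    rw [hm, ← Matrix.mulVec_mulVec, ← Matrix.mulVec_mulVec]
    have hz : (Matrix.diagonal fun i => (l i + 1) * (l i + 2)).mulVec (U.transpose.mulVec x) = 0 := by
      funext i
      rw [Matrix.mulVec_diagonal]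
      rcases hrest i with rfl | rfl | rfl | hi | hi
      · simp [x₁]
      · simp [x₂]
      · simp [x₃]
      all_goals simp [hi]
    rw [hz, Matrix.mulVec_zero]

end Spectral

/-! ### Orthogonal complements and radicals of the shifted forms -/

/-- An affine function of t that is bounded above on the whole line has slope zero. -/
lemma eq_zero_of_quadratic_nonpos {q l : ℝ} (h : ∀ t : ℝ, q + 2 * t * l ≤ 0) : l = 0 := by
  by_contra hl
  have := h ((1 - q) / (2 * l))
  rw [show q + 2 * ((1 - q) / (2 * l)) * l = 1 by field_simp; ring] at this
  linarith

lemma exists_combination_two {W : Type*} (c : (W → ℝ) →ₗ[ℝ] ℝ) (s y : W → ℝ) :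
    ∃ α γ : ℝ, (α ≠ 0 ∨ γ ≠ 0) ∧ c (α • s + γ • y) = 0 := by
  by_cases h : c s = 0
  · exact ⟨1, 0, by simp, by simp [h]⟩
  · exact ⟨-c y, c s, Or.inr h, by simp; ring⟩

lemma exists_combination_three {W : Type*} (c₁ c₂ : (W → ℝ) →ₗ[ℝ] ℝ)
    (s₁ s₂ y : W → ℝ) :
    ∃ α β γ : ℝ, (α ≠ 0 ∨ β ≠ 0 ∨ γ ≠ 0) ∧
      c₁ (α • s₁ + β • s₂ + γ • y) = 0 ∧ c₂ (α • s₁ + β • s₂ + γ • y) = 0 := by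
  let T : (Fin 3 → ℝ) →ₗ[ℝ] (Fin 2 → ℝ) :=
    Matrix.mulVecLin !![c₁ s₁, c₁ s₂, c₁ y; c₂ s₁, c₂ s₂, c₂ y]
  have hT : LinearMap.ker T ≠ ⊥ := LinearMap.ker_ne_bot_of_finrank_lt (by simp)
  obtain ⟨g, hg, hg0⟩ := (Submodule.ne_bot_iff _).mp hT
  have h0 := congrFun hg 0
  have h1 := congrFun hg 1
  simp [T, Matrix.mulVec, dotProduct, Fin.sum_univ_three] at h0 h1
  refine ⟨g 0, g 1, g 2, ?_, ?_, ?_⟩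
  · by_contra hcon
    push Not at hcon
    apply hg0
    funext i
    fin_cases i
    exacts [hcon.1, hcon.2.1, hcon.2.2]
  · simp only [map_add, map_smul, smul_eq_mul]; linarith
  · simp only [map_add, map_smul, smul_eq_mul]; linarith

section Forms

variable {W : Type*} [Fintype W] [DecidableEq W] {D : Matrix W W ℝ}

/-- The bilinear form of `D + t I`. -/
noncomputable def shiftForm (D : Matrix W W ℝ) (t : ℝ) : LinearMap.BilinForm ℝ (W → ℝ) :=
  Matrix.toBilin' (D + t • 1)

lemma shiftForm_single (D : Matrix W W ℝ) (t : ℝ) (x y : W) :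
    shiftForm D t (Pi.single x 1) (Pi.single y 1) = D x y + if x = y then t else 0 := by
  simp [shiftForm, Matrix.toBilin'_single, Matrix.one_apply]

lemma shiftForm_comm (hD : D.IsSymm) (t : ℝ) (x y : W → ℝ) :
    shiftForm D t x y = shiftForm D t y x := by
  have h : (D + t • (1 : Matrix W W ℝ)).transpose = D + t • 1 := by
    rw [Matrix.transpose_add, Matrix.transpose_smul, Matrix.transpose_one, hD.eq]
  rw [shiftForm, Matrix.toBilin'_apply', Matrix.toBilin'_apply', Matrix.dotProduct_mulVec,
    ← Matrix.mulVec_transpose, h, dotProduct_comm]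

namespace HasPendantInertia

variable (hD : HasPendantInertia D)
include hD

/-- Three pairwise orthogonal positive vectors would span a positive definite space of dimension 3,
which must meet the subspace of codimension 2 on which the form is nonpositive. -/
lemma one_nonpos {s₁ s₂ y : W → ℝ} (h₁ : 0 < shiftForm D 1 s₁ s₁) (h₂ : 0 < shiftForm D 1 s₂ s₂)
    (h₁₂ : shiftForm D 1 s₁ s₂ = 0) (hy₁ : shiftForm D 1 s₁ y = 0)
    (hy₂ : shiftForm D 1 s₂ y = 0) : shiftForm D 1 y y ≤ 0 := by
  by_contra! hy
  obtain ⟨c₁, c₂, hc⟩ := hD.one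
  obtain ⟨α, β, γ, hne, e₁, e₂⟩ := exists_combination_three c₁ c₂ s₁ s₂ y
  have h := hc _ e₁ e₂
  change shiftForm D 1 _ _ ≤ 0 at h
  simp only [map_add, map_smul, LinearMap.add_apply, LinearMap.smul_apply, smul_eq_mul,
    shiftForm_comm hD.isSymm 1 s₂ s₁, shiftForm_comm hD.isSymm 1 y s₁,
    shiftForm_comm hD.isSymm 1 y s₂, h₁₂, hy₁, hy₂] at h
  have a₁ : 0 ≤ α * α * shiftForm D 1 s₁ s₁ := mul_nonneg (mul_self_nonneg _) h₁.le
  have a₂ : 0 ≤ β * β * shiftForm D 1 s₂ s₂ := mul_nonneg (mul_self_nonneg _) h₂.le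
  have a₃ : 0 ≤ γ * γ * shiftForm D 1 y y := mul_nonneg (mul_self_nonneg _) hy.le
  rcases hne with hne | hne | hne
  · have : 0 < α * α * shiftForm D 1 s₁ s₁ := mul_pos (mul_self_pos.mpr hne) h₁
    nlinarith
  · have : 0 < β * β * shiftForm D 1 s₂ s₂ := mul_pos (mul_self_pos.mpr hne) h₂
    nlinarith
  · have : 0 < γ * γ * shiftForm D 1 y y := mul_pos (mul_self_pos.mpr hne) hy
    nlinarith

lemma two_nonneg {s y : W → ℝ} (h : shiftForm D 2 s s < 0) (hy : shiftForm D 2 s y = 0) :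
    0 ≤ shiftForm D 2 y y := by
  by_contra! hy'
  obtain ⟨c, hc⟩ := hD.two
  obtain ⟨α, γ, hne, e⟩ := exists_combination_two c s y
  have h' := hc _ e
  change 0 ≤ shiftForm D 2 _ _ at h'
  simp only [map_add, map_smul, LinearMap.add_apply, LinearMap.smul_apply, smul_eq_mul,
    shiftForm_comm hD.isSymm 2 y s, hy] at h'
  have a₁ : α * α * shiftForm D 2 s s ≤ 0 :=
    mul_nonpos_of_nonneg_of_nonpos (mul_self_nonneg _) h.le
  have a₃ : γ * γ * shiftForm D 2 y y ≤ 0 :=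
    mul_nonpos_of_nonneg_of_nonpos (mul_self_nonneg _) hy'.le
  rcases hne with hne | hne
  · have : α * α * shiftForm D 2 s s < 0 := mul_neg_of_pos_of_neg (mul_self_pos.mpr hne) h
    nlinarith
  · have : γ * γ * shiftForm D 2 y y < 0 := mul_neg_of_pos_of_neg (mul_self_pos.mpr hne) hy'
    nlinarith

lemma zero_neg {s y : W → ℝ} (h : 0 < shiftForm D 0 s s) (hy : shiftForm D 0 s y = 0)
    (hy0 : y ≠ 0) : shiftForm D 0 y y < 0 := by
  by_contra! hy'
  obtain ⟨c, hc⟩ := hD.zero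
  obtain ⟨α, γ, hne, e⟩ := exists_combination_two c s y
  have hexp : shiftForm D 0 (α • s + γ • y) (α • s + γ • y) =
      α * α * shiftForm D 0 s s + γ * γ * shiftForm D 0 y y := by
    simp only [map_add, map_smul, LinearMap.add_apply, LinearMap.smul_apply, smul_eq_mul,
      shiftForm_comm hD.isSymm 0 y s, hy]
    ring
  have a₁ : 0 ≤ α * α * shiftForm D 0 s s := mul_nonneg (mul_self_nonneg _) h.le
  have a₃ : 0 ≤ γ * γ * shiftForm D 0 y y := mul_nonneg (mul_self_nonneg _) hy'
  -- The strict inequality of `hD.zero` holds only for nonzero vectors. A vanishing combination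
  -- would force α = 0 by the value of the form, and then γ y = 0.
  have hx : α • s + γ • y ≠ 0 := by
    intro hz
    rw [hz, map_zero] at hexp
    rcases eq_or_ne α 0 with rfl | hα
    · rw [zero_smul, zero_add, smul_eq_zero] at hz
      rcases hz with h0 | h0
      · exact hne.elim (absurd rfl) (absurd h0)
      · exact hy0 h0
    · have : 0 < α * α * shiftForm D 0 s s := mul_pos (mul_self_pos.mpr hα) h
      linarith
  have h' := hc _ hx e
  change shiftForm D 0 _ _ < 0 at h'
  linarith

/-- On the orthogonal complement of `s₁, s₂` the form is nonpositive, so an isotropic vector there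
is orthogonal to the complement. It is also orthogonal to `s₁` and `s₂`, hence to everything. -/
lemma one_isotropic {s₁ s₂ w : W → ℝ} (h₁ : 0 < shiftForm D 1 s₁ s₁)
    (h₂ : 0 < shiftForm D 1 s₂ s₂) (h₁₂ : shiftForm D 1 s₁ s₂ = 0)
    (hw₁ : shiftForm D 1 s₁ w = 0) (hw₂ : shiftForm D 1 s₂ w = 0)
    (hw : shiftForm D 1 w w = 0) (z : W → ℝ) : shiftForm D 1 w z = 0 := by
  set α := shiftForm D 1 s₁ z / shiftForm D 1 s₁ s₁ with hα
  set β := shiftForm D 1 s₂ z / shiftForm D 1 s₂ s₂ with hβ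
  have hα' : α * shiftForm D 1 s₁ s₁ = shiftForm D 1 s₁ z := div_mul_cancel₀ _ h₁.ne'
  have hβ' : β * shiftForm D 1 s₂ s₂ = shiftForm D 1 s₂ z := div_mul_cancel₀ _ h₂.ne'
  set z' := z - α • s₁ - β • s₂ with hz'
  have hs : ∀ x y, shiftForm D 1 x y = shiftForm D 1 y x := shiftForm_comm hD.isSymm 1
  have o₁ : shiftForm D 1 s₁ z' = 0 := by
    simp only [hz', map_sub, map_smul, smul_eq_mul, h₁₂]
    linarith
  have o₂ : shiftForm D 1 s₂ z' = 0 := by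
    simp only [hz', map_sub, map_smul, smul_eq_mul, hs s₂ s₁, h₁₂]
    linarith
  have ow : shiftForm D 1 w z' = shiftForm D 1 w z := by
    simp [hz', hs w s₁, hs w s₂, hw₁, hw₂]
  rw [← ow]
  refine eq_zero_of_quadratic_nonpos (q := shiftForm D 1 z' z') fun t => ?_
  have h := hD.one_nonpos (y := z' + t • w) h₁ h₂ h₁₂ (by simp [o₁, hw₁]) (by simp [o₂, hw₂])
  simp only [map_add, map_smul, LinearMap.add_apply, LinearMap.smul_apply, smul_eq_mul, hw,
    hs z' w] at h
  linarith

lemma two_isotropic {s w : W → ℝ} (h : shiftForm D 2 s s < 0) (hsw : shiftForm D 2 s w = 0)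
    (hw : shiftForm D 2 w w = 0) (z : W → ℝ) : shiftForm D 2 w z = 0 := by
  set α := shiftForm D 2 s z / shiftForm D 2 s s with hα
  have hα' : α * shiftForm D 2 s s = shiftForm D 2 s z := div_mul_cancel₀ _ h.ne
  set z' := z - α • s with hz'
  have hs : ∀ x y, shiftForm D 2 x y = shiftForm D 2 y x := shiftForm_comm hD.isSymm 2
  have o : shiftForm D 2 s z' = 0 := by
    simp only [hz', map_sub, map_smul, smul_eq_mul]
    linarith
  have ow : shiftForm D 2 w z' = shiftForm D 2 w z := by
    simp [hz', hs w s, hsw]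
  rw [← ow, ← neg_eq_zero]
  refine eq_zero_of_quadratic_nonpos (q := -shiftForm D 2 z' z') fun t => ?_
  have h' := hD.two_nonneg (y := z' + t • w) h (by simp [o, hsw])
  simp only [map_add, map_smul, LinearMap.add_apply, LinearMap.smul_apply, smul_eq_mul, hw,
    hs z' w] at h'
  linarith

end HasPendantInertia

end Forms

section Comb

variable {W : Type*} [Fintype W] [DecidableEq W]

/-- The vector supported on the points `p i` with coefficients `c i`. -/
def pointVector {k : ℕ} (p : Fin k → W) (c : Fin k → ℝ) : W → ℝ :=
  ∑ i, c i • Pi.single (p i) (1 : ℝ)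

lemma shiftForm_pointVector (D : Matrix W W ℝ) (t : ℝ) {k : ℕ} (p : Fin k → W)
    (c c' : Fin k → ℝ) :
    shiftForm D t (pointVector p c) (pointVector p c') =
      ∑ i, ∑ j, c i * (c' j * (D (p i) (p j) + if p i = p j then t else 0)) := by
  simp only [pointVector, map_sum, map_smul, LinearMap.sum_apply, LinearMap.smul_apply,
    smul_eq_mul, shiftForm_single]
  rw [Finset.sum_comm]
  simp only [Finset.mul_sum]
  refine Finset.sum_congr rfl fun i _ => Finset.sum_congr rfl fun j _ => by ring

end Comb

/-! ### Twins and forbidden configurations -/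

namespace SimpleGraph

lemma distanceMatrix_isSymm {W : Type*} (G : SimpleGraph W) : G.distanceMatrix.IsSymm := by
  ext x y
  simp [distanceMatrix, G.dist_comm]

variable {W : Type*} [Fintype W] [DecidableEq W] {G : SimpleGraph W}

/-- Reduces every configuration to arithmetic with a literal matrix `M`. The points are distinct
because off-diagonal entries of `M` are nonzero. -/
lemma shiftForm_points (hG : G.Connected) {k : ℕ} (p : Fin k → W) (M : Fin k → Fin k → ℕ)
    (hM : ∀ i j, i < j → G.dist (p i) (p j) = M i j) (hMs : ∀ i j, M i j = M j i)
    (hM0 : ∀ i j, M i j = 0 ↔ i = j) (t : ℝ)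
    (c c' : Fin k → ℝ) :
    shiftForm G.distanceMatrix t (pointVector p c) (pointVector p c') =
      ∑ i, ∑ j, c i * (c' j * ((M i j : ℝ) + if i = j then t else 0)) := by
  rw [shiftForm_pointVector]
  replace hM : ∀ i j, G.dist (p i) (p j) = M i j := by
    intro i j
    rcases lt_trichotomy i j with h | h | h
    · exact hM i j h
    · rw [h, dist_self, (hM0 j j).mpr rfl]
    · rw [G.dist_comm, hMs, hM j i h]
  refine Finset.sum_congr rfl fun i _ => Finset.sum_congr rfl fun j _ => ?_
  have h : p i = p j ↔ i = j := by
    rw [← hM0, ← hM, hG.dist_eq_zero_iff]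
  simp only [distanceMatrix, Matrix.of_apply, hM, h]

lemma dist_eq_of_shiftForm_one {x u v : W} (hvx : v ≠ x) (hvu : v ≠ u)
    (h : shiftForm G.distanceMatrix 1 (Pi.single u 1 - Pi.single x 1) (Pi.single v 1) = 0) :
    G.dist u v = G.dist x v := by
  rw [map_sub, LinearMap.sub_apply, shiftForm_single, shiftForm_single, if_neg hvu.symm,
    if_neg hvx.symm, add_zero, add_zero, sub_eq_zero] at h
  simpa [distanceMatrix] using h

lemma dist_eq_of_shiftForm_two {x u v : W} (hvx : v ≠ x) (hvu : v ≠ u)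
    (h : shiftForm G.distanceMatrix 2 (Pi.single u 1 - Pi.single x 1) (Pi.single v 1) = 0) :
    G.dist u v = G.dist x v := by
  rw [map_sub, LinearMap.sub_apply, shiftForm_single, shiftForm_single, if_neg hvu.symm,
    if_neg hvx.symm, add_zero, add_zero, sub_eq_zero] at h
  simpa [distanceMatrix] using h

section Forbidden

variable (hG : G.Connected) (hI : HasPendantInertia G.distanceMatrix)
include hG hI

/-- On the induced path x, y, z the vectors e_y and e_x - 2e_y + e_z are orthogonal and positive for
D + I. As u sees y and z as x does and is adjacent to x, e_u - e_x is isotropic and orthogonal to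
both, hence in the kernel of D + I. -/
lemma dist_eq_of_trueTwin_end {x y z u : W} (hxy : G.dist x y = 1) (hxz : G.dist x z = 2)
    (hyz : G.dist y z = 1) (hxu : G.dist x u = 1) (hyu : G.dist y u = 1) (hzu : G.dist z u = 2)
    {v : W} (hv : v ≠ x) (hvu : v ≠ u) : G.dist u v = G.dist x v := by
  have hF := shiftForm_points hG ![x, y, z, u]
    ![![0, 1, 2, 1], ![1, 0, 1, 1], ![2, 1, 0, 2], ![1, 1, 2, 0]]
    (by
      intro i j hij
      fin_cases i <;> fin_cases j <;> simp_all)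
    (by decide) (by decide) 1
  have hw : pointVector ![x, y, z, u] ![-1, 0, 0, 1] = Pi.single u 1 - Pi.single x 1 := by
    simp [pointVector, Fin.sum_univ_four]
    abel
  refine dist_eq_of_shiftForm_one hv hvu ?_
  rw [← hw]
  refine hI.one_isotropic (s₁ := pointVector ![x, y, z, u] ![0, 1, 0, 0])
    (s₂ := pointVector ![x, y, z, u] ![1, -2, 1, 0]) ?_ ?_ ?_ ?_ ?_ ?_ _
  all_goals
    rw [hF]
    simp [Fin.sum_univ_succ]
    try norm_num

lemma dist_eq_of_trueTwin_mid {x y z u : W} (hxy : G.dist x y = 1) (hxz : G.dist x z = 2)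
    (hyz : G.dist y z = 1) (hxu : G.dist x u = 1) (hyu : G.dist y u = 1) (hzu : G.dist z u = 1)
    {v : W} (hv : v ≠ y) (hvu : v ≠ u) : G.dist u v = G.dist y v := by
  have hF := shiftForm_points hG ![x, y, z, u]
    ![![0, 1, 2, 1], ![1, 0, 1, 1], ![2, 1, 0, 1], ![1, 1, 1, 0]]
    (by
      intro i j hij
      fin_cases i <;> fin_cases j <;> simp_all)
    (by decide) (by decide) 1
  have hw : pointVector ![x, y, z, u] ![0, -1, 0, 1] = Pi.single u 1 - Pi.single y 1 := by
    simp [pointVector, Fin.sum_univ_four]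
    abel
  refine dist_eq_of_shiftForm_one hv hvu ?_
  rw [← hw]
  refine hI.one_isotropic (s₁ := pointVector ![x, y, z, u] ![0, 1, 0, 0])
    (s₂ := pointVector ![x, y, z, u] ![1, -2, 1, 0]) ?_ ?_ ?_ ?_ ?_ ?_ _
  all_goals
    rw [hF]
    simp [Fin.sum_univ_succ]
    try norm_num

/-- The alternating vector is in the kernel of the distance matrix of the 4-cycle and is orthogonal
to the positive all-ones vector. -/
lemma no_fourCycle {x y z w : W} (hxy : G.dist x y = 1) (hxz : G.dist x z = 2)
    (hxw : G.dist x w = 1) (hyz : G.dist y z = 1) (hyw : G.dist y w = 2) (hzw : G.dist z w = 1) :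
    False := by
  have hF := shiftForm_points hG ![x, y, z, w]
    ![![0, 1, 2, 1], ![1, 0, 1, 2], ![2, 1, 0, 1], ![1, 2, 1, 0]]
    (by
      intro i j hij
      fin_cases i <;> fin_cases j <;> simp_all)
    (by decide) (by decide) 0
  have h1 : shiftForm G.distanceMatrix 0 (pointVector ![x, y, z, w] ![1, -1, 1, -1])
      (pointVector ![x, y, z, w] ![1, -1, 1, -1]) < 0 := by
    refine hI.zero_neg (s := pointVector ![x, y, z, w] ![1, 1, 1, 1]) ?_ ?_ ?_
    · rw [hF]
      simp [Fin.sum_univ_succ]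
      norm_num
    · rw [hF]
      simp [Fin.sum_univ_succ]
      norm_num
    · intro h0
      have hne : ∀ v, G.dist x v ≠ 0 → x ≠ v := by
        rintro v hv rfl
        simp at hv
      have := congrFun h0 x
      simp [pointVector, Fin.sum_univ_succ, hne y (by omega), hne z (by omega),
        hne w (by omega)] at this
  rw [hF] at h1
  simp [Fin.sum_univ_succ] at h1
  norm_num at h1

/-- The 5-cycle has a double distance eigenvalue below -2, whereas D + 2I allows one negative
direction. -/
lemma no_fiveCycle {a b c d e : W} (hab : G.dist a b = 1) (hac : G.dist a c = 2)
    (had : G.dist a d = 2) (hae : G.dist a e = 1) (hbc : G.dist b c = 1) (hbd : G.dist b d = 2)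
    (hbe : G.dist b e = 2) (hcd : G.dist c d = 1) (hce : G.dist c e = 2) (hde : G.dist d e = 1) :
    False := by
  have hF := shiftForm_points hG ![a, b, c, d, e]
    ![![0, 1, 2, 2, 1], ![1, 0, 1, 2, 2], ![2, 1, 0, 1, 2], ![2, 2, 1, 0, 1], ![1, 2, 2, 1, 0]]
    (by
      intro i j hij
      fin_cases i <;> fin_cases j <;> simp_all)
    (by decide) (by decide) 2
  have h1 := hI.two_nonneg (s := pointVector ![a, b, c, d, e] ![0, 1, 1, -1, -1])
    (y := pointVector ![a, b, c, d, e] ![2, 1, -2, -2, 1])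
    (by rw [hF]; simp [Fin.sum_univ_succ]; norm_num)
    (by rw [hF]; simp [Fin.sum_univ_succ]; norm_num)
  rw [hF] at h1
  simp [Fin.sum_univ_succ] at h1
  norm_num at h1

/-- Two negative directions of D + 2I: one separates the two edges, the other separates the edges
from the isolated vertex. -/
lemma no_two_edges_and_vertex {a b c d e : W} (hab : G.dist a b = 1) (hac : G.dist a c = 2)
    (had : G.dist a d = 2) (hae : G.dist a e = 2) (hbc : G.dist b c = 2) (hbd : G.dist b d = 2)
    (hbe : G.dist b e = 2) (hcd : G.dist c d = 1) (hce : G.dist c e = 2) (hde : G.dist d e = 2) :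
    False := by
  have hF := shiftForm_points hG ![a, b, c, d, e]
    ![![0, 1, 2, 2, 2], ![1, 0, 2, 2, 2], ![2, 2, 0, 1, 2], ![2, 2, 1, 0, 2], ![2, 2, 2, 2, 0]]
    (by
      intro i j hij
      fin_cases i <;> fin_cases j <;> simp_all)
    (by decide) (by decide) 2
  have h1 := hI.two_nonneg (s := pointVector ![a, b, c, d, e] ![1, 1, -1, -1, 0])
    (y := pointVector ![a, b, c, d, e] ![1, 1, 1, 1, -3])
    (by rw [hF]; simp [Fin.sum_univ_succ]; norm_num)
    (by rw [hF]; simp [Fin.sum_univ_succ]; norm_num)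
  rw [hF] at h1
  simp [Fin.sum_univ_succ] at h1
  norm_num at h1

end Forbidden

end SimpleGraph

/-! ### Position of a vertex relative to a geodesic path on four vertices -/

/-- Search through 256 quadruples. The `t` hypotheses are triangle inequalities; `q1`, `q2`, `q0`
are the inertia conditions for D + I, D + 2I and D on the path together with one further vertex. -/
lemma four_distances_of_ineqs {a b c d : ℕ} (a0 : a ≠ 0) (b0 : b ≠ 0) (c0 : c ≠ 0) (d0 : d ≠ 0)
    (a4 : a ≤ 4) (b4 : b ≤ 4) (c4 : c ≤ 4) (d4 : d ≤ 4) (t1 : a ≤ b + 1) (t2 : b ≤ a + 1)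
    (t3 : b ≤ c + 1) (t4 : c ≤ b + 1) (t5 : c ≤ d + 1) (t6 : d ≤ c + 1) (t7 : 3 ≤ a + d)
    (q1 : (1 : ℤ) ≤ a * (b + 2 * c - a - d) + b * (a - b - 3 * c + 2 * d)
      + c * (2 * a - 3 * b - c + d) + d * (2 * b + c - a - d))
    (q2 : a * (-3 * b + 3 * d) + b * (-3 * a + 4 * b + c) + c * (b + 4 * c - 3 * d)
      + d * (3 * a - 3 * c) ≤ (12 : ℤ))
    (q0 : (0 : ℤ) < a * (-2 * a + 3 * b + d) + b * (3 * a - 6 * b + 3 * c)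
      + c * (3 * b - 6 * c + 3 * d) + d * (a + 3 * c - 2 * d)) :
    (a = 1 ∧ b = 1 ∧ c = 1 ∧ d = 2) ∨ (a = 1 ∧ b = 1 ∧ c = 2 ∧ d = 3) ∨
    (a = 2 ∧ b = 1 ∧ c = 1 ∧ d = 1) ∨ (a = 3 ∧ b = 2 ∧ c = 1 ∧ d = 1) ∨
    (a = 2 ∧ b = 1 ∧ c = 2 ∧ d = 3) ∨ (a = 3 ∧ b = 2 ∧ c = 1 ∧ d = 2) ∨
    (a = 2 ∧ b = 1 ∧ c = 2 ∧ d = 2) ∨ (a = 2 ∧ b = 2 ∧ c = 1 ∧ d = 2) := by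
  have key : ∀ a ∈ Finset.Icc (1 : ℕ) 4, ∀ b ∈ Finset.Icc (1 : ℕ) 4,
      ∀ c ∈ Finset.Icc (1 : ℕ) 4, ∀ d ∈ Finset.Icc (1 : ℕ) 4,
      (a ≤ b + 1 ∧ b ≤ a + 1 ∧ b ≤ c + 1 ∧ c ≤ b + 1 ∧ c ≤ d + 1 ∧ d ≤ c + 1 ∧ 3 ≤ a + d) ∧
      ((1 : ℤ) ≤ a * (b + 2 * c - a - d) + b * (a - b - 3 * c + 2 * d)
        + c * (2 * a - 3 * b - c + d) + d * (2 * b + c - a - d) ∧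
      a * (-3 * b + 3 * d) + b * (-3 * a + 4 * b + c) + c * (b + 4 * c - 3 * d)
        + d * (3 * a - 3 * c) ≤ (12 : ℤ) ∧
      (0 : ℤ) < a * (-2 * a + 3 * b + d) + b * (3 * a - 6 * b + 3 * c)
        + c * (3 * b - 6 * c + 3 * d) + d * (a + 3 * c - 2 * d)) →
      (a, b, c, d) ∈ [(1, 1, 1, 2), (1, 1, 2, 3), (2, 1, 1, 1), (3, 2, 1, 1), (2, 1, 2, 3),
        (3, 2, 1, 2), (2, 1, 2, 2), (2, 2, 1, 2)] := by
    decide +kernel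
  have := key a (Finset.mem_Icc.mpr ⟨by omega, a4⟩) b (Finset.mem_Icc.mpr ⟨by omega, b4⟩)
    c (Finset.mem_Icc.mpr ⟨by omega, c4⟩) d (Finset.mem_Icc.mpr ⟨by omega, d4⟩)
    ⟨⟨t1, t2, t3, t4, t5, t6, t7⟩, q1, q2, q0⟩
  simpa using this

namespace SimpleGraph

/-- `p₀, p₁, p₂, p₃` is a geodesic path. -/
structure IsGeodesicFour {W : Type*} (G : SimpleGraph W) (p₀ p₁ p₂ p₃ : W) : Prop where
  d01 : G.dist p₀ p₁ = 1
  d02 : G.dist p₀ p₂ = 2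
  d03 : G.dist p₀ p₃ = 3
  d12 : G.dist p₁ p₂ = 1
  d13 : G.dist p₁ p₃ = 2
  d23 : G.dist p₂ p₃ = 1

lemma IsGeodesicFour.symm {W : Type*} {G : SimpleGraph W}
    {p₀ p₁ p₂ p₃ : W}
    (h : IsGeodesicFour G p₀ p₁ p₂ p₃) : IsGeodesicFour G p₃ p₂ p₁ p₀ :=
  ⟨by rw [G.dist_comm, h.d23], by rw [G.dist_comm, h.d13], by rw [G.dist_comm, h.d03],
    by rw [G.dist_comm, h.d12], by rw [G.dist_comm, h.d02], by rw [G.dist_comm, h.d01]⟩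

variable {W : Type*} [Fintype W] [DecidableEq W] {G : SimpleGraph W}

variable (hG : G.Connected) (hI : HasPendantInertia G.distanceMatrix)
include hG

lemma shiftForm_geodesicFour {p₀ p₁ p₂ p₃ : W} (h : IsGeodesicFour G p₀ p₁ p₂ p₃) {u : W}
    {a b c d : ℕ} (ha : G.dist p₀ u = a) (hb : G.dist p₁ u = b) (hc : G.dist p₂ u = c)
    (hd : G.dist p₃ u = d) (a0 : a ≠ 0) (b0 : b ≠ 0) (c0 : c ≠ 0) (d0 : d ≠ 0) (t : ℝ)
    (f g : Fin 5 → ℝ) :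
    shiftForm G.distanceMatrix t (pointVector ![p₀, p₁, p₂, p₃, u] f)
      (pointVector ![p₀, p₁, p₂, p₃, u] g) =
      f 0 * (g 0 * t + g 1 + g 2 * 2 + g 3 * 3 + g 4 * a) +
      f 1 * (g 0 + g 1 * t + g 2 + g 3 * 2 + g 4 * b) +
      f 2 * (g 0 * 2 + g 1 + g 2 * t + g 3 + g 4 * c) +
      f 3 * (g 0 * 3 + g 1 * 2 + g 2 + g 3 * t + g 4 * d) +
      f 4 * (g 0 * a + g 1 * b + g 2 * c + g 3 * d + g 4 * t) := by
  rw [shiftForm_points hG ![p₀, p₁, p₂, p₃, u]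
    ![![0, 1, 2, 3, a], ![1, 0, 1, 2, b], ![2, 1, 0, 1, c], ![3, 2, 1, 0, d], ![a, b, c, d, 0]]]
  · simp [Fin.sum_univ_five]
    ring
  · obtain ⟨h1, h2, h3, h4, h5, h6⟩ := h
    intro i j hij
    fin_cases i <;> fin_cases j <;> simp_all
  · intro i j
    fin_cases i <;> fin_cases j <;> rfl
  · intro i j
    fin_cases i <;> fin_cases j <;> simp [*]

include hI

/-- A Schur complement: the vector `y` is e_u minus its projection to the span of the path, with
coefficients read off the inverse of the 4 × 4 block of D + I. `geodesicFour_two` and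
`geodesicFour_zero` do the same for D + 2I and D, scaled by 6 to clear denominators. -/
lemma geodesicFour_one {p₀ p₁ p₂ p₃ : W} (h : IsGeodesicFour G p₀ p₁ p₂ p₃) {u : W}
    {a b c d : ℕ} (ha : G.dist p₀ u = a) (hb : G.dist p₁ u = b) (hc : G.dist p₂ u = c)
    (hd : G.dist p₃ u = d) (a0 : a ≠ 0) (b0 : b ≠ 0) (c0 : c ≠ 0) (d0 : d ≠ 0) :
    (1 : ℤ) ≤ a * (b + 2 * c - a - d) + b * (a - b - 3 * c + 2 * d)
      + c * (2 * a - 3 * b - c + d) + d * (2 * b + c - a - d) := by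
  have hF := shiftForm_geodesicFour hG h ha hb hc hd a0 b0 c0 d0
  have h1 := hI.one_nonpos (s₁ := pointVector ![p₀, p₁, p₂, p₃, u] ![0, 1, 0, 0, 0])
    (s₂ := pointVector ![p₀, p₁, p₂, p₃, u] ![1, -2, 1, 0, 0])
    (y := pointVector ![p₀, p₁, p₂, p₃, u] ![-(b + 2 * c - a - d), -(a - b - 3 * c + 2 * d),
      -(2 * a - 3 * b - c + d), -(2 * b + c - a - d), 1])
    (by rw [hF]; simp) (by rw [hF]; simp; norm_num) (by rw [hF]; simp; norm_num)
    (by rw [hF]; simp; ring) (by rw [hF]; simp; ring)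
  rw [hF] at h1
  simp at h1
  have h2 : (1 : ℝ) ≤ a * (b + 2 * c - a - d) + b * (a - b - 3 * c + 2 * d)
      + c * (2 * a - 3 * b - c + d) + d * (2 * b + c - a - d) := by linarith
  exact_mod_cast h2

lemma geodesicFour_two {p₀ p₁ p₂ p₃ : W} (h : IsGeodesicFour G p₀ p₁ p₂ p₃) {u : W}
    {a b c d : ℕ} (ha : G.dist p₀ u = a) (hb : G.dist p₁ u = b) (hc : G.dist p₂ u = c)
    (hd : G.dist p₃ u = d) (a0 : a ≠ 0) (b0 : b ≠ 0) (c0 : c ≠ 0) (d0 : d ≠ 0) :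
    a * (-3 * b + 3 * d) + b * (-3 * a + 4 * b + c) + c * (b + 4 * c - 3 * d)
      + d * (3 * a - 3 * c) ≤ (12 : ℤ) := by
  have hF := shiftForm_geodesicFour hG h ha hb hc hd a0 b0 c0 d0
  have h1 := hI.two_nonneg (s := pointVector ![p₀, p₁, p₂, p₃, u] ![1, 0, 0, -1, 0])
    (y := pointVector ![p₀, p₁, p₂, p₃, u] ![-(-3 * b + 3 * d), -(-3 * a + 4 * b + c),
      -(b + 4 * c - 3 * d), -(3 * a - 3 * c), 6])
    (by rw [hF]; simp; norm_num) (by rw [hF]; simp; ring)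
  rw [hF] at h1
  simp at h1
  have h2 : a * (-3 * b + 3 * d) + b * (-3 * a + 4 * b + c) + c * (b + 4 * c - 3 * d)
      + d * (3 * a - 3 * c) ≤ (12 : ℝ) := by linarith
  exact_mod_cast h2

lemma geodesicFour_zero {p₀ p₁ p₂ p₃ : W} (h : IsGeodesicFour G p₀ p₁ p₂ p₃) {u : W}
    {a b c d : ℕ} (ha : G.dist p₀ u = a) (hb : G.dist p₁ u = b) (hc : G.dist p₂ u = c)
    (hd : G.dist p₃ u = d) (a0 : a ≠ 0) (b0 : b ≠ 0) (c0 : c ≠ 0) (d0 : d ≠ 0) :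
    (0 : ℤ) < a * (-2 * a + 3 * b + d) + b * (3 * a - 6 * b + 3 * c) + c * (3 * b - 6 * c + 3 * d)
      + d * (a + 3 * c - 2 * d) := by
  have hF := shiftForm_geodesicFour hG h ha hb hc hd a0 b0 c0 d0
  have h1 := hI.zero_neg (s := pointVector ![p₀, p₁, p₂, p₃, u] ![0, 1, 1, 0, 0])
    (y := pointVector ![p₀, p₁, p₂, p₃, u] ![-(-2 * a + 3 * b + d), -(3 * a - 6 * b + 3 * c),
      -(3 * b - 6 * c + 3 * d), -(a + 3 * c - 2 * d), 6])
    (by rw [hF]; simp) (by rw [hF]; simp; ring) (by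
      intro h0
      have hne : ∀ v, G.dist v u ≠ 0 → u ≠ v := by
        rintro v hv rfl
        simp at hv
      have := congrFun h0 u
      simp [pointVector, Fin.sum_univ_five, hne p₀ (by omega), hne p₁ (by omega),
        hne p₂ (by omega), hne p₃ (by omega)] at this)
  rw [hF] at h1
  simp at h1
  have h2 : (0 : ℝ) < a * (-2 * a + 3 * b + d) + b * (3 * a - 6 * b + 3 * c)
      + c * (3 * b - 6 * c + 3 * d) + d * (a + 3 * c - 2 * d) := by linarith
  exact_mod_cast h2

lemma geodesicFour_types {p₀ p₁ p₂ p₃ : W} (h : IsGeodesicFour G p₀ p₁ p₂ p₃) {u : W}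
    {a b c d : ℕ} (ha : G.dist p₀ u = a) (hb : G.dist p₁ u = b) (hc : G.dist p₂ u = c)
    (hd : G.dist p₃ u = d) (a0 : a ≠ 0) (b0 : b ≠ 0) (c0 : c ≠ 0) (d0 : d ≠ 0)
    (a4 : a ≤ 4) (b4 : b ≤ 4) (c4 : c ≤ 4) (d4 : d ≤ 4) :
    (a = 1 ∧ b = 1 ∧ c = 1 ∧ d = 2) ∨ (a = 1 ∧ b = 1 ∧ c = 2 ∧ d = 3) ∨
    (a = 2 ∧ b = 1 ∧ c = 1 ∧ d = 1) ∨ (a = 3 ∧ b = 2 ∧ c = 1 ∧ d = 1) ∨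
    (a = 2 ∧ b = 1 ∧ c = 2 ∧ d = 3) ∨ (a = 3 ∧ b = 2 ∧ c = 1 ∧ d = 2) ∨
    (a = 2 ∧ b = 1 ∧ c = 2 ∧ d = 2) ∨ (a = 2 ∧ b = 2 ∧ c = 1 ∧ d = 2) := by
  have q1 := geodesicFour_one hG hI h ha hb hc hd a0 b0 c0 d0
  have q2 := geodesicFour_two hG hI h ha hb hc hd a0 b0 c0 d0
  have q0 := geodesicFour_zero hG hI h ha hb hc hd a0 b0 c0 d0
  have t1 : a ≤ b + 1 := by
    have := hG.dist_triangle (u := p₀) (v := p₁) (w := u)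
    rw [h.d01] at this; omega
  have t2 : b ≤ a + 1 := by
    have := hG.dist_triangle (u := p₁) (v := p₀) (w := u)
    rw [h.symm.d23] at this; omega
  have t3 : b ≤ c + 1 := by
    have := hG.dist_triangle (u := p₁) (v := p₂) (w := u)
    rw [h.d12] at this; omega
  have t4 : c ≤ b + 1 := by
    have := hG.dist_triangle (u := p₂) (v := p₁) (w := u)
    rw [h.symm.d12] at this; omega
  have t5 : c ≤ d + 1 := by
    have := hG.dist_triangle (u := p₂) (v := p₃) (w := u)
    rw [h.d23] at this; omega
  have t6 : d ≤ c + 1 := by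
    have := hG.dist_triangle (u := p₃) (v := p₂) (w := u)
    rw [h.symm.d01] at this; omega
  have t7 : 3 ≤ a + d := by
    have := hG.dist_triangle (u := p₀) (v := u) (w := p₃)
    rw [h.d03, G.dist_comm (u := u)] at this; omega
  exact four_distances_of_ineqs a0 b0 c0 d0 a4 b4 c4 d4 t1 t2 t3 t4 t5 t6 t7 q1 q2 q0

end SimpleGraph

/-! ### Graphs with a geodesic path on four vertices are blow-ups of it -/

namespace SimpleGraph

lemma Connected.exists_dist_eq_and_adj {W : Type*} {G : SimpleGraph W} (hG : G.Connected) {x y : W}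
    {k : ℕ} (h : G.dist x y = k + 1) : ∃ z, G.dist x z = k ∧ G.dist z y = 1 := by
  -- The walk runs from `y` to `x`, so that its first step exhibits the neighbour of `y`.
  obtain ⟨q, hq⟩ := hG.exists_walk_length_eq_dist y x
  rw [G.dist_comm, h] at hq
  cases q with
  | nil => simp at hq
  | @cons _ z _ hyz q =>
    have h1 : G.dist z y = 1 := dist_eq_one_iff_adj.mpr hyz.symm
    have h2 : G.dist z x ≤ k := (dist_le q).trans (by simpa using hq.le)
    have h3 := hG.dist_triangle (u := x) (v := z) (w := y)
    rw [G.dist_comm] at h2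
    exact ⟨z, by omega, h1⟩

lemma Connected.exists_dist_eq {W : Type*} {G : SimpleGraph W} (hG : G.Connected) {x y : W}
    {k : ℕ} (h : k ≤ G.dist x y) : ∃ z, G.dist x z = k := by
  induction hn : G.dist x y - k generalizing y with
  | zero => exact ⟨y, by omega⟩
  | succ n ih =>
    obtain ⟨z, hz, -⟩ := hG.exists_dist_eq_and_adj (x := x) (y := y) (k := G.dist x y - 1)
      (by omega)
    exact ih (y := z) (by omega) (by omega)

lemma Connected.exists_isGeodesicFour {W : Type*} {G : SimpleGraph W} (hG : G.Connected) {x y : W}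
    (h : G.dist x y = 3) : ∃ z₁ z₂, IsGeodesicFour G x z₁ z₂ y := by
  obtain ⟨z₂, h02, h23⟩ := hG.exists_dist_eq_and_adj h
  obtain ⟨z₁, h01, h12⟩ := hG.exists_dist_eq_and_adj h02
  have t1 := hG.dist_triangle (u := x) (v := z₁) (w := y)
  have t2 := hG.dist_triangle (u := z₁) (v := z₂) (w := y)
  exact ⟨z₁, z₂, h01, h02, h, h12, by omega, h23⟩

/-- Distances between the classes of a graph obtained from a path with four vertices by
replacing vertices by twins. -/
def pathDist (e f : ℝ) : Fin 4 → Fin 4 → ℝ :=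
  ![![e, 1, 2, 3], ![1, 1, 1, 2], ![2, 1, 1, 1], ![3, 2, 1, f]]

lemma pathDist_of_ne (e f e' f' : ℝ) {i j : Fin 4} (h : i ≠ j) :
    pathDist e f i j = pathDist e' f' i j := by
  fin_cases i <;> fin_cases j <;> simp [pathDist] at h ⊢

lemma IsGeodesicFour.dist_eq {W : Type*} {G : SimpleGraph W} {p : Fin 4 → W}
    (h : IsGeodesicFour G (p 0) (p 1) (p 2) (p 3)) (i j : Fin 4) :
    (G.dist (p i) (p j) : ℝ) = if i = j then 0 else pathDist 1 1 i j := by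
  have hs := h.symm
  obtain ⟨a1, a2, a3, a4, a5, a6⟩ := h
  obtain ⟨b1, b2, b3, b4, b5, b6⟩ := hs
  fin_cases i <;> fin_cases j <;> simp [pathDist, *]

lemma IsGeodesicFour.injective {W : Type*} {G : SimpleGraph W} {p : Fin 4 → W}
    (h : IsGeodesicFour G (p 0) (p 1) (p 2) (p 3)) : Function.Injective p := by
  intro i j hij
  by_contra hne
  have h0 := h.dist_eq i j
  rw [hij, dist_self, if_neg hne] at h0
  clear hij h
  fin_cases i <;> fin_cases j <;> simp [pathDist] at h0 hne

variable {W : Type*} [Fintype W] [DecidableEq W] {G : SimpleGraph W}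

section Classes

variable (hG : G.Connected) (hI : HasPendantInertia G.distanceMatrix)
include hG hI

/-- A vertex at distance 4 would have distances 4, 3, 2, 1 to a geodesic path, which is not among
the admissible quadruples. -/
lemma dist_le_three (x y : W) : G.dist x y ≤ 3 := by
  by_contra! hlt
  obtain ⟨u, hu⟩ := hG.exists_dist_eq (show 4 ≤ G.dist x y by omega)
  obtain ⟨p₃, h3, h3u⟩ := hG.exists_dist_eq_and_adj hu
  obtain ⟨p₁, p₂, hp⟩ := hG.exists_isGeodesicFour h3
  have t1 := hG.dist_triangle (u := x) (v := p₁) (w := u)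
  have t2 := hG.dist_triangle (u := p₁) (v := p₃) (w := u)
  have t3 := hG.dist_triangle (u := x) (v := p₂) (w := u)
  have t4 := hG.dist_triangle (u := p₂) (v := p₃) (w := u)
  rw [hp.d01] at t1
  rw [hp.d13] at t2
  rw [hp.d02] at t3
  rw [hp.d23] at t4
  have := geodesicFour_types hG hI hp hu (show G.dist p₁ u = 3 by omega)
    (show G.dist p₂ u = 2 by omega) h3u
  omega

/-- Since u and `p₀` are at distance 2, e_u - e_{p₀} is isotropic for D + 2I, and it is orthogonal
to the negative vector e_{p₀} - e_{p₃}. -/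
lemma dist_eq_of_falseTwin {p₀ p₁ p₂ p₃ : W} (h : IsGeodesicFour G p₀ p₁ p₂ p₃) {u : W}
    (ha : G.dist p₀ u = 2) (hb : G.dist p₁ u = 1) (hc : G.dist p₂ u = 2) (hd : G.dist p₃ u = 3)
    {v : W} (hv : v ≠ p₀) (hvu : v ≠ u) : G.dist u v = G.dist p₀ v := by
  have hF := shiftForm_geodesicFour hG h ha hb hc hd (by simp) (by simp) (by simp) (by simp)
  have hw : pointVector ![p₀, p₁, p₂, p₃, u] ![-1, 0, 0, 0, 1] =
      Pi.single u 1 - Pi.single p₀ 1 := by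
    simp [pointVector, Fin.sum_univ_five]
    abel
  refine dist_eq_of_shiftForm_two hv hvu ?_
  rw [← hw]
  refine hI.two_isotropic (s := pointVector ![p₀, p₁, p₂, p₃, u] ![1, 0, 0, -1, 0]) ?_ ?_ ?_ _
  all_goals
    rw [hF]
    simp
    try norm_num

/-- A common neighbour m of `p₃` and u must be a twin of `p₂` or of `p₃`. Both are at distance 2
from u, but m is adjacent to it. -/
lemma geodesicFour_no_pendant {p₀ p₁ p₂ p₃ : W} (h : IsGeodesicFour G p₀ p₁ p₂ p₃) {u : W}
    (hc : G.dist p₂ u = 2) (hd : G.dist p₃ u = 2) : False := by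
  obtain ⟨m, hm3, hmu⟩ := hG.exists_dist_eq_and_adj hd
  have hm0 : G.dist p₀ m ≠ 0 := fun h0 => by
    rw [hG.dist_eq_zero_iff] at h0
    rw [← h0, h.symm.d03] at hm3
    omega
  have hm1 : G.dist p₁ m ≠ 0 := fun h0 => by
    rw [hG.dist_eq_zero_iff] at h0
    rw [← h0, h.symm.d02] at hm3
    omega
  have hm2 : G.dist p₂ m ≠ 0 := fun h0 => by
    rw [hG.dist_eq_zero_iff] at h0
    rw [← h0, hc] at hmu
    omega
  have hu2 : u ≠ p₂ := by rintro rfl; simp at hc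
  have hu3 : u ≠ p₃ := by rintro rfl; simp at hd
  have hum : u ≠ m := by rintro rfl; simp at hmu
  have hle := dist_le_three hG hI
  rcases geodesicFour_types hG hI h rfl rfl rfl rfl hm0 hm1 hm2 (by omega)
    ((hle _ _).trans (by omega)) ((hle _ _).trans (by omega)) ((hle _ _).trans (by omega))
    ((hle _ _).trans (by omega)) with h' | h' | h' | h' | h' | h' | h' | h' <;>
    obtain ⟨e0, e1, e2, e3⟩ := h' <;> try omega
  · have := dist_eq_of_trueTwin_mid hG hI h.d12 h.d13 h.d23 e1 e2 e3 hu2 hum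
    omega
  · have := dist_eq_of_trueTwin_end hG hI h.symm.d01 h.symm.d02 h.symm.d12 e3 e2 e1 hu3 hum
    omega

/-- The alternatives for a vertex outside of a geodesic path with four vertices. -/
lemma geodesicFour_twins {p : Fin 4 → W} (h : IsGeodesicFour G (p 0) (p 1) (p 2) (p 3)) (u : W)
    (hu : ∀ i, u ≠ p i) :
    ∃ i, (∀ v, v ≠ p i → v ≠ u → G.dist u v = G.dist (p i) v) ∧
      (G.dist (p i) u = 1 ∨ (i = 0 ∨ i = 3) ∧ G.dist (p i) u = 2) := by
  have hle := fun x y => (dist_le_three hG hI x y).trans (show 3 ≤ 4 by omega)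
  have hne : ∀ i, G.dist (p i) u ≠ 0 := fun i h0 => hu i (hG.dist_eq_zero_iff.mp h0).symm
  rcases geodesicFour_types hG hI h rfl rfl rfl rfl (hne 0) (hne 1) (hne 2) (hne 3)
    (hle _ _) (hle _ _) (hle _ _) (hle _ _) with h' | h' | h' | h' | h' | h' | h' | h' <;>
    obtain ⟨e0, e1, e2, e3⟩ := h'
  · exact ⟨1, fun v hv hvu => dist_eq_of_trueTwin_mid hG hI h.d01 h.d02 h.d12 e0 e1 e2 hv hvu,
      Or.inl e1⟩
  · exact ⟨0, fun v hv hvu => dist_eq_of_trueTwin_end hG hI h.d01 h.d02 h.d12 e0 e1 e2 hv hvu,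
      Or.inl e0⟩
  · exact ⟨2, fun v hv hvu => dist_eq_of_trueTwin_mid hG hI h.d12 h.d13 h.d23 e1 e2 e3 hv hvu,
      Or.inl e2⟩
  · exact ⟨3, fun v hv hvu => dist_eq_of_trueTwin_end hG hI h.symm.d01 h.symm.d02 h.symm.d12
      e3 e2 e1 hv hvu, Or.inl e3⟩
  · exact ⟨0, fun v hv hvu => dist_eq_of_falseTwin hG hI h e0 e1 e2 e3 hv hvu,
      Or.inr ⟨Or.inl rfl, e0⟩⟩
  · exact ⟨3, fun v hv hvu => dist_eq_of_falseTwin hG hI h.symm e3 e2 e1 e0 hv hvu,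
      Or.inr ⟨Or.inr rfl, e3⟩⟩
  · exact (geodesicFour_no_pendant hG hI h e2 e3).elim
  · exact (geodesicFour_no_pendant hG hI h.symm e1 e0).elim

lemma exists_pathDist_blocks {p : Fin 4 → W} (h : IsGeodesicFour G (p 0) (p 1) (p 2) (p 3)) :
    ∃ (κ : W → Fin 4) (e f : ℝ), Function.Surjective κ ∧
      G.distanceMatrix = blockMatrix κ (pathDist e f) ∧
      (e = 2 ∨ e = 1 ∧ 2 ≤ classSize κ 0) ∧ (f = 2 ∨ f = 1 ∧ 2 ≤ classSize κ 3) := by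
  classical
  have hex : ∀ u, ∃ i, u = p i ∨ (∀ j, u ≠ p j) ∧
      (∀ v, v ≠ p i → v ≠ u → G.dist u v = G.dist (p i) v) ∧
      (G.dist (p i) u = 1 ∨ (i = 0 ∨ i = 3) ∧ G.dist (p i) u = 2) := by
    intro u
    by_cases hu : ∃ i, u = p i
    · exact ⟨hu.choose, Or.inl hu.choose_spec⟩
    · push Not at hu
      obtain ⟨i, hi⟩ := geodesicFour_twins hG hI h u hu
      exact ⟨i, Or.inr ⟨hu, hi⟩⟩
  choose κ hκ using hex
  have hpinj := h.injective
  have hκp : ∀ i, κ (p i) = i := by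
    intro i
    rcases hκ (p i) with h' | h'
    · exact (hpinj h').symm
    · exact absurd rfl (h'.1 i)
  have htw : ∀ u, u ≠ p (κ u) → (∀ v, v ≠ p (κ u) → v ≠ u → G.dist u v = G.dist (p (κ u)) v) ∧
      (G.dist (p (κ u)) u = 1 ∨ (κ u = 0 ∨ κ u = 3) ∧ G.dist (p (κ u)) u = 2) := by
    intro u hu
    rcases hκ u with h' | h'
    · exact absurd h' hu
    · exact h'.2
  -- Two twins u, v of p satisfy d(p, u) = d(v, u) = d(p, v), so a class contains only true twins or
  -- only false twins.
  have hsame : ∀ u v, u ≠ p (κ u) → v ≠ p (κ v) → κ u = κ v →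
      G.dist (p (κ u)) u = G.dist (p (κ u)) v := by
    intro u v hu hv huv
    rcases eq_or_ne u v with rfl | hne
    · rfl
    · rw [← (htw u hu).1 v (huv ▸ hv) hne.symm, huv, ← (htw v hv).1 u (huv ▸ hu) hne, G.dist_comm]
  -- The value 2 is also the default for a class without twins, whose diagonal entry never occurs;
  -- thus the value 1 implies at least two members.
  let ε : Fin 4 → ℝ := fun i => if ∃ u, κ u = i ∧ G.dist (p i) u = 1 ∧ u ≠ p i then 1 else 2
  have hε : ∀ u, u ≠ p (κ u) → (G.dist (p (κ u)) u : ℝ) = ε (κ u) := by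
    intro u hu
    by_cases hc : ∃ v, κ v = κ u ∧ G.dist (p (κ u)) v = 1 ∧ v ≠ p (κ u)
    · simp only [ε, if_pos hc]
      obtain ⟨v, hv1, hv2, hv3⟩ := hc
      rw [hsame u v hu (hv1 ▸ hv3) hv1.symm, hv2, Nat.cast_one]
    · simp only [ε, if_neg hc]
      rcases (htw u hu).2 with h' | h'
      · exact absurd ⟨u, rfl, h', hu⟩ hc
      · rw [h'.2, Nat.cast_ofNat]
  have hε1 : ∀ u, u ≠ p (κ u) → κ u = 1 ∨ κ u = 2 → (G.dist (p (κ u)) u : ℝ) = 1 := by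
    intro u hu hu12
    rcases (htw u hu).2 with h' | h'
    · rw [h', Nat.cast_one]
    · rcases hu12 with h1 | h1 <;> simp [h1] at h'
  have hpd : ∀ u, u ≠ p (κ u) →
      (G.dist (p (κ u)) u : ℝ) = pathDist (ε 0) (ε 3) (κ u) (κ u) := by
    intro u hu
    have h1 := hε u hu
    have h2 := hε1 u hu
    generalize κ u = i at h1 h2 ⊢
    fin_cases i
    · simpa [pathDist] using h1
    · simpa [pathDist] using h2 (by simp)
    · simpa [pathDist] using h2 (by simp)
    · simpa [pathDist] using h1
  have hcross : ∀ i j, i ≠ j → (G.dist (p i) (p j) : ℝ) = pathDist (ε 0) (ε 3) i j := by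
    intro i j hij
    rw [h.dist_eq, if_neg hij]
    exact pathDist_of_ne _ _ _ _ hij
  have hbase : ∀ i v, v ≠ p i → (G.dist (p i) v : ℝ) = pathDist (ε 0) (ε 3) i (κ v) := by
    intro i v hv
    by_cases hvp : v = p (κ v)
    · have hne : i ≠ κ v := by
        rintro rfl
        exact hv hvp
      rw [← hcross i _ hne, ← hvp]
    · by_cases hi : i = κ v
      · subst hi
        exact hpd v hvp
      · rw [G.dist_comm, (htw v hvp).1 (p i) (fun h' => hi (hpinj h')) hv.symm, G.dist_comm,
          hcross i _ hi]
  have hmat : G.distanceMatrix = blockMatrix κ (pathDist (ε 0) (ε 3)) := by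
    ext x y
    simp only [distanceMatrix, blockMatrix, Matrix.of_apply]
    split_ifs with hxy
    · rw [hxy, dist_self, Nat.cast_zero]
    · by_cases hx : x = p (κ x)
      · have := hbase (κ x) y (fun h' => hxy (hx.trans h'.symm))
        rwa [← hx] at this
      · by_cases hy : y = p (κ x)
        · rw [G.dist_comm, show κ y = κ x by rw [hy, hκp], ← hpd x hx, ← hy]
        · rw [(htw x hx).1 y hy (Ne.symm hxy), hbase _ _ hy]
  have hsize : ∀ i, ε i = 2 ∨ ε i = 1 ∧ 2 ≤ classSize κ i := by
    intro i
    by_cases hc : ∃ u, κ u = i ∧ G.dist (p i) u = 1 ∧ u ≠ p i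
    · right
      refine ⟨if_pos hc, ?_⟩
      obtain ⟨u, hu1, -, hu3⟩ := hc
      exact Fintype.one_lt_card_iff.mpr ⟨⟨u, hu1⟩, ⟨p i, hκp i⟩, fun h' => hu3 (Subtype.ext_iff.mp h')⟩
    · exact Or.inl (if_neg hc)
  exact ⟨κ, ε 0, ε 3, fun i => ⟨p i, hκp i⟩, hmat, hsize 0, hsize 3⟩

end Classes

end SimpleGraph

/-! ### Excluding the blow-ups of the path -/

open SimpleGraph

/-- Functions constant on classes form a 4-dimensional space, so a nonzero one is annihilated by the
three functionals of `hI.rank`. Hence (Q + 1)(Q + 2) is singular for the quotient Q. -/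
lemma det_quotientMatrix_eq_zero {W : Type*} [Fintype W] [DecidableEq W] {κ : W → Fin 4}
    (hκ : Function.Surjective κ) {m : Fin 4 → Fin 4 → ℝ}
    (hI : HasPendantInertia (blockMatrix κ m)) :
    (quotientMatrix κ m + (1 : ℝ) • (1 : Matrix (Fin 4) (Fin 4) ℝ)).det = 0 ∨
      (quotientMatrix κ m + (2 : ℝ) • (1 : Matrix (Fin 4) (Fin 4) ℝ)).det = 0 := by
  obtain ⟨c₁, c₂, c₃, hc⟩ := hI.rank
  let P : (Fin 4 → ℝ) →ₗ[ℝ] (W → ℝ) := LinearMap.funLeft ℝ ℝ κ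
  let T : (Fin 4 → ℝ) →ₗ[ℝ] (Fin 3 → ℝ) := LinearMap.pi ![c₁ ∘ₗ P, c₂ ∘ₗ P, c₃ ∘ₗ P]
  have hT : LinearMap.ker T ≠ ⊥ := LinearMap.ker_ne_bot_of_finrank_lt (by simp)
  obtain ⟨g, hg, hg0⟩ := (Submodule.ne_bot_iff _).mp hT
  have hstep : ∀ (t : ℝ) (g : Fin 4 → ℝ), (blockMatrix κ m + t • 1).mulVec (g ∘ κ) =
      (quotientMatrix κ m + t • 1).mulVec g ∘ κ := by
    intro t g
    rw [Matrix.add_mulVec, Matrix.add_mulVec, blockMatrix_mulVec_comp, Matrix.smul_mulVec,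
      Matrix.smul_mulVec, Matrix.one_mulVec, Matrix.one_mulVec]
    rfl
  have h := hc (g ∘ κ) (congrFun hg 0) (congrFun hg 1) (congrFun hg 2)
  rw [hstep, hstep] at h
  have h' : (quotientMatrix κ m + (1 : ℝ) • (1 : Matrix (Fin 4) (Fin 4) ℝ)).mulVec
      ((quotientMatrix κ m + (2 : ℝ) • (1 : Matrix (Fin 4) (Fin 4) ℝ)).mulVec g) = 0 := by
    funext i
    obtain ⟨x, rfl⟩ := hκ i
    exact congrFun h x
  by_cases h2 : (quotientMatrix κ m + (2 : ℝ) • (1 : Matrix (Fin 4) (Fin 4) ℝ)).mulVec g = 0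
  · exact Or.inr (Matrix.exists_mulVec_eq_zero_iff.mp ⟨g, hg0, h2⟩)
  · exact Or.inl (Matrix.exists_mulVec_eq_zero_iff.mp ⟨_, h2, h'⟩)

section PathDist

variable {W : Type*} [Fintype W] [DecidableEq W] (κ : W → Fin 4)

lemma det_quotientMatrix_pathDist {W : Type*} [Fintype W] (κ : W → Fin 4) (e f t : ℝ)
    {x y z w : ℝ} (hx : (classSize κ 0 : ℝ) = x) (hy : (classSize κ 1 : ℝ) = y)
    (hz : (classSize κ 2 : ℝ) = z) (hw : (classSize κ 3 : ℝ) = w) :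
    (quotientMatrix κ (pathDist e f) + t • (1 : Matrix (Fin 4) (Fin 4) ℝ)).det =
      !![e * x - e + t, y, 2 * z, 3 * w; x, y - 1 + t, z, 2 * w; 2 * x, y, z - 1 + t, w;
        3 * x, 2 * y, z, f * w - f + t].det := by
  congr 1
  ext i j
  fin_cases i <;> fin_cases j <;> simp [quotientMatrix, pathDist, *]

lemma det_pathDist_one_two_one_pos {W : Type*} [Fintype W] {κ : W → Fin 4}
    (hκ : ∀ i, 1 ≤ (classSize κ i : ℝ)) :
    0 < (quotientMatrix κ (pathDist 1 2) + (1 : ℝ) • (1 : Matrix (Fin 4) (Fin 4) ℝ)).det := by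
  have h : ∀ x y z w : ℝ, !![1 * x - 1 + 1, y, 2 * z, 3 * w; x, y - 1 + 1, z, 2 * w;
      2 * x, y, z - 1 + 1, w; 3 * x, 2 * y, z, 2 * w - 2 + 1].det = x * y * z := by
    intro x y z w
    simp [Matrix.det_succ_row_zero, Fin.sum_univ_succ, Fin.succAbove]
    ring
  have p₀ := hκ 0
  have p₁ := hκ 1
  have p₂ := hκ 2
  have p₃ := hκ 3
  rw [det_quotientMatrix_pathDist κ _ _ _ rfl rfl rfl rfl, h]
  positivity

lemma det_pathDist_two_one_one_pos {W : Type*} [Fintype W] {κ : W → Fin 4}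
    (hκ : ∀ i, 1 ≤ (classSize κ i : ℝ)) :
    0 < (quotientMatrix κ (pathDist 2 1) + (1 : ℝ) • (1 : Matrix (Fin 4) (Fin 4) ℝ)).det := by
  have h : ∀ x y z w : ℝ, !![2 * x - 2 + 1, y, 2 * z, 3 * w; x, y - 1 + 1, z, 2 * w;
      2 * x, y, z - 1 + 1, w; 3 * x, 2 * y, z, 1 * w - 1 + 1].det = y * z * w := by
    intro x y z w
    simp [Matrix.det_succ_row_zero, Fin.sum_univ_succ, Fin.succAbove]
    ring
  have p₀ := hκ 0
  have p₁ := hκ 1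
  have p₂ := hκ 2
  have p₃ := hκ 3
  rw [det_quotientMatrix_pathDist κ _ _ _ rfl rfl rfl rfl, h]
  positivity

lemma det_pathDist_one_two_two_neg {W : Type*} [Fintype W] {κ : W → Fin 4}
    (hκ : ∀ i, 1 ≤ (classSize κ i : ℝ)) :
    (quotientMatrix κ (pathDist 1 2) + (2 : ℝ) • (1 : Matrix (Fin 4) (Fin 4) ℝ)).det < 0 := by
  have h : ∀ x y z w : ℝ, !![1 * x - 1 + 2, y, 2 * z, 3 * w; x, y - 1 + 2, z, 2 * w;
      2 * x, y, z - 1 + 2, w; 3 * x, 2 * y, z, 2 * w - 2 + 2].det = -(w * (y * (x + z + 2) + z * (4 * x - 1) + (7 * x - 2))) := by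
    intro x y z w
    simp [Matrix.det_succ_row_zero, Fin.sum_univ_succ, Fin.succAbove]
    ring
  have p₀ := hκ 0
  have p₁ := hκ 1
  have p₂ := hκ 2
  have p₃ := hκ 3
  rw [det_quotientMatrix_pathDist κ _ _ _ rfl rfl rfl rfl, h]
  refine neg_neg_of_pos (mul_pos (by linarith) (add_pos (add_pos ?_ ?_) (by linarith)))
  · positivity
  · exact mul_pos (by linarith) (by linarith)

lemma det_pathDist_two_one_two_neg {W : Type*} [Fintype W] {κ : W → Fin 4}
    (hκ : ∀ i, 1 ≤ (classSize κ i : ℝ)) :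
    (quotientMatrix κ (pathDist 2 1) + (2 : ℝ) • (1 : Matrix (Fin 4) (Fin 4) ℝ)).det < 0 := by
  have h : ∀ x y z w : ℝ, !![2 * x - 2 + 2, y, 2 * z, 3 * w; x, y - 1 + 2, z, 2 * w;
      2 * x, y, z - 1 + 2, w; 3 * x, 2 * y, z, 1 * w - 1 + 2].det = -(x * (z * (w + y + 2) + y * (4 * w - 1) + (7 * w - 2))) := by
    intro x y z w
    simp [Matrix.det_succ_row_zero, Fin.sum_univ_succ, Fin.succAbove]
    ring
  have p₀ := hκ 0
  have p₁ := hκ 1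
  have p₂ := hκ 2
  have p₃ := hκ 3
  rw [det_quotientMatrix_pathDist κ _ _ _ rfl rfl rfl rfl, h]
  refine neg_neg_of_pos (mul_pos (by linarith) (add_pos (add_pos ?_ ?_) (by linarith)))
  · positivity
  · exact mul_pos (by linarith) (by linarith)

lemma det_pathDist_two_two_two_neg {W : Type*} [Fintype W] {κ : W → Fin 4}
    (hκ : ∀ i, 1 ≤ (classSize κ i : ℝ)) :
    (quotientMatrix κ (pathDist 2 2) + (2 : ℝ) • (1 : Matrix (Fin 4) (Fin 4) ℝ)).det < 0 := by
  have h : ∀ x y z w : ℝ, !![2 * x - 2 + 2, y, 2 * z, 3 * w; x, y - 1 + 2, z, 2 * w;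
      2 * x, y, z - 1 + 2, w; 3 * x, 2 * y, z, 2 * w - 2 + 2].det = -(x * w * (5 + y * z + 3 * y + 3 * z)) := by
    intro x y z w
    simp [Matrix.det_succ_row_zero, Fin.sum_univ_succ, Fin.succAbove]
    ring
  have p₀ := hκ 0
  have p₁ := hκ 1
  have p₂ := hκ 2
  have p₃ := hκ 3
  rw [det_quotientMatrix_pathDist κ _ _ _ rfl rfl rfl rfl, h]
  exact neg_neg_of_pos (by positivity)

lemma eq_of_det_pathDist_two_two_one {W : Type*} [Fintype W] {κ : W → Fin 4}
    (hκ : ∀ i, 1 ≤ (classSize κ i : ℝ)) 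
    (h0 : (quotientMatrix κ (pathDist 2 2) + (1 : ℝ) • (1 : Matrix (Fin 4) (Fin 4) ℝ)).det = 0) :
    (classSize κ 0 : ℝ) + classSize κ 3 = classSize κ 0 * classSize κ 3 := by
  have h : ∀ x y z w : ℝ, !![2 * x - 2 + 1, y, 2 * z, 3 * w; x, y - 1 + 1, z, 2 * w;
      2 * x, y, z - 1 + 1, w; 3 * x, 2 * y, z, 2 * w - 2 + 1].det = y * z * (w + x - x * w) := by
    intro x y z w
    simp [Matrix.det_succ_row_zero, Fin.sum_univ_succ, Fin.succAbove]
    ring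
  have p₀ := hκ 0
  have p₁ := hκ 1
  have p₂ := hκ 2
  have p₃ := hκ 3
  rw [det_quotientMatrix_pathDist κ _ _ _ rfl rfl rfl rfl, h] at h0
  have hyz : (classSize κ 1 : ℝ) * classSize κ 2 ≠ 0 := by positivity
  have := (mul_eq_zero.mp h0).resolve_left hyz
  linarith

lemma sum_sq_pathDist (e f : ℝ) :
    ∑ x, ∑ y, blockMatrix κ (pathDist e f) x y ^ 2 =
      e ^ 2 * (classSize κ 0 ^ 2 - classSize κ 0) + (classSize κ 1 ^ 2 - classSize κ 1)
      + (classSize κ 2 ^ 2 - classSize κ 2) + f ^ 2 * (classSize κ 3 ^ 2 - classSize κ 3)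
      + 2 * (classSize κ 0 * classSize κ 1 + 4 * classSize κ 0 * classSize κ 2
        + 9 * classSize κ 0 * classSize κ 3 + classSize κ 1 * classSize κ 2
        + 4 * classSize κ 1 * classSize κ 3 + classSize κ 2 * classSize κ 3) := by
  rw [sum_sq_blockMatrix]
  simp [Fin.sum_univ_four, pathDist]
  ring

lemma pathDist_count_neg_one :
    classSize κ 0 + classSize κ 1 + classSize κ 2 + classSize κ 3 ≤
      (blockMatrix κ (pathDist 1 1)).charpoly.roots.count (-1) + 4 := by
  have h := sum_classSize_le_count κ (pathDist 1 1) 1 Finset.univ (by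
    intro c; fin_cases c <;> simp [pathDist])
  simpa [Fin.sum_univ_four] using h

/-- A connected graph with a geodesic path of length three does not have the distance spectrum of
`K_n^h`. -/
lemma blockMatrix_pathDist_false {κ : W → Fin 4} {e f : ℝ} (hκ : Function.Surjective κ)
    (he : e = 2 ∨ e = 1 ∧ 2 ≤ classSize κ 0) (hf : f = 2 ∨ f = 1 ∧ 2 ≤ classSize κ 3)
    (hI : HasPendantInertia (blockMatrix κ (pathDist e f))) {a b : ℕ} (ha : 2 ≤ a) (hb : 1 ≤ b)
    (hcard : Fintype.card W = a + b + 1)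
    (hcount : (blockMatrix κ (pathDist e f)).charpoly.roots.count (-1) = a - 1)
    (hsq : ∑ x, ∑ y, blockMatrix κ (pathDist e f) x y ^ 2 =
      (1 + a + b : ℝ) ^ 2 - (1 + a + b) + 3 * (2 * a * b + b ^ 2 - b)) : False := by
  have hpos : ∀ i, 1 ≤ classSize κ i := fun i => by
    obtain ⟨x, hx⟩ := hκ i
    exact Fintype.card_pos_iff.mpr ⟨⟨x, hx⟩⟩
  have hpos' : ∀ i, 1 ≤ (classSize κ i : ℝ) := fun i => by exact_mod_cast hpos i
  have hdet := det_quotientMatrix_eq_zero hκ hI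
  have hsum := card_eq_sum_classSize κ
  rw [Fin.sum_univ_four, hcard] at hsum
  rw [sum_sq_pathDist] at hsq
  have p₀ := hpos 0
  have p₁ := hpos 1
  have p₂ := hpos 2
  have p₃ := hpos 3
  rcases he with rfl | ⟨rfl, he⟩ <;> rcases hf with rfl | ⟨rfl, hf⟩
  · have hxw := eq_of_det_pathDist_two_two_one hpos'
      (hdet.resolve_right (det_pathDist_two_two_two_neg hpos').ne)
    generalize classSize κ 0 = x at *
    generalize classSize κ 1 = y at *
    generalize classSize κ 2 = z at *
    generalize classSize κ 3 = w at *
    norm_cast at hxw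
    have hx : x = 2 ∧ w = 2 := by
      have h1 : (x - 1 : ℤ) * (w - 1) = 1 := by
        have : (x : ℤ) + w = x * w := by exact_mod_cast hxw
        linarith
      rcases Int.eq_one_or_neg_one_of_mul_eq_one' h1 with h | h <;> omega
    obtain ⟨rfl, rfl⟩ := hx
    have hsum' : (a : ℝ) + b + 1 = 2 + y + z + 2 := by exact_mod_cast hsum
    -- The trace of D² is impossible modulo 3, as 3 does not divide 76.
    have h1 : (3 * (2 * a * b + b ^ 2 - b) : ℝ) = 12 * (y + z) + 76 := by
      rw [show (1 + a + b : ℝ) = 2 + y + z + 2 by linarith] at hsq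
      push_cast at hsq
      linarith
    have h2 : (3 * (2 * a * b + b ^ 2 - b) : ℤ) = 12 * (y + z) + 76 := by exact_mod_cast h1
    generalize (2 * a * b + b ^ 2 - b : ℤ) = k at h2
    omega
  · exact hdet.elim (det_pathDist_two_one_one_pos hpos').ne' (det_pathDist_two_one_two_neg hpos').ne
  · exact hdet.elim (det_pathDist_one_two_one_pos hpos').ne' (det_pathDist_one_two_two_neg hpos').ne
  -- Here -1 has multiplicity at least |W| - 4, so b ≤ 2. The distances 3 between the end classes,
  -- each of size at least 2, then make the trace of D² too large.
  · have hc := pathDist_count_neg_one κ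
    rw [hcount] at hc
    generalize classSize κ 0 = x at *
    generalize classSize κ 1 = y at *
    generalize classSize κ 2 = z at *
    generalize classSize κ 3 = w at *
    have hsum' : (a : ℝ) + b + 1 = x + y + z + w := by exact_mod_cast hsum
    rw [show (1 + a + b : ℝ) = x + y + z + w by linarith] at hsq
    have hx : (2 : ℝ) ≤ x := by exact_mod_cast he
    have hw : (2 : ℝ) ≤ w := by exact_mod_cast hf
    have hxz : 0 ≤ ((x : ℝ) - 2) * z := mul_nonneg (by linarith) (by positivity)
    have hyw : 0 ≤ (y : ℝ) * (w - 2) := mul_nonneg (by positivity) (by linarith)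
    have hxw : 0 ≤ ((x : ℝ) - 2) * (w - 2) := mul_nonneg (by linarith) (by linarith)
    have hb2 : b = 1 ∨ b = 2 := by omega
    rcases hb2 with rfl | rfl
    · push_cast at hsq hsum'
      nlinarith
    · push_cast at hsq hsum'
      nlinarith

end PathDist

/-! ### Class sizes from spectral data -/

section SplitNumerics

variable {W : Type*} [Fintype W] [DecidableEq W] {κ : W → Fin 3}

/-- The multiplicities bound s + p by a + 1 and q by b, so equality holds in both; the trace of D²
then gives p = a. -/
lemma classSize_of_splitDist {a b : ℕ} (ha : 2 ≤ a) (hb : 1 ≤ b)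
    (hcard : Fintype.card W = a + b + 1)
    (hone : (blockMatrix κ splitDist).charpoly.roots.count (-1) = a - 1)
    (htwo : (blockMatrix κ splitDist).charpoly.roots.count (-2) = b - 1)
    (hsq : ∑ x, ∑ y, blockMatrix κ splitDist x y ^ 2 =
      (1 + a + b : ℝ) ^ 2 - (1 + a + b) + 3 * (2 * a * b + b ^ 2 - b)) :
    classSize κ 0 = 1 ∧ classSize κ 1 = a ∧ classSize κ 2 = b := by
  have h1 := splitDist_count_neg_one κ
  have h2 := splitDist_count_neg_two κ
  have h3 := card_eq_sum_classSize κ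
  rw [Fin.sum_univ_three, hcard] at h3
  rw [hone] at h1
  rw [htwo] at h2
  rw [sum_sq_splitDist] at hsq
  generalize classSize κ 0 = s at *
  generalize classSize κ 1 = p at *
  generalize classSize κ 2 = q at *
  obtain rfl : q = b := by omega
  have h4 : (a : ℝ) + q + 1 = s + p + q := by exact_mod_cast h3
  rw [show (s + p + q : ℝ) = 1 + a + q by linarith] at hsq
  have hq : (q : ℝ) ≠ 0 := by positivity
  have h5 : (p : ℝ) = a := mul_right_cancel₀ hq (by linarith)
  have h6 : p = a := by exact_mod_cast h5
  omega

/-- With all diagonal values 1, (r + 1)f is determined by the class sums of an eigenvector f. For r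
≠ -1 these sums do not all vanish, and they form an eigenvector of the transposed quotient. No class
needs to be nonempty. -/
lemma det_eq_zero_of_mem_roots {ι : Type*} [Fintype ι] [DecidableEq ι] {κ : W → ι}
    {m : ι → ι → ℝ} (hm : ∀ c, m c c = 1) {r : ℝ} (hr : r ≠ -1)
    (h : 1 ≤ (blockMatrix κ m).charpoly.roots.count r) :
    (Matrix.of (fun c d => (classSize κ c : ℝ) * m c d) - (r + 1) • (1 : Matrix ι ι ℝ)).det = 0 := by
  rw [Multiset.one_le_count_iff_mem, Polynomial.mem_roots (Matrix.charpoly_monic _).ne_zero] at h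
  have h1 : Module.End.HasEigenvalue (Matrix.toLin' (blockMatrix κ m)) r :=
    (Module.End.hasEigenvalue_iff_isRoot_charpoly _ _).mpr (by simpa using h)
  obtain ⟨f, hf, hf0⟩ := h1.exists_hasEigenvector
  rw [Module.End.mem_eigenspace_iff, Matrix.toLin'_apply] at hf
  have h2 : ∀ x, (r + 1) * f x = ∑ c, m (κ x) c * ∑ y with κ y = c, f y := by
    intro x
    have := congrFun hf x
    rw [blockMatrix_mulVec, hm, Pi.smul_apply, smul_eq_mul] at this
    linarith
  rw [← Matrix.exists_mulVec_eq_zero_iff]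
  refine ⟨fun c => ∑ y with κ y = c, f y, ?_, ?_⟩
  · intro h0
    apply hf0
    funext x
    have h3 := h2 x
    rw [Finset.sum_eq_zero fun c _ => by rw [show ∑ y with κ y = c, f y = 0 from congrFun h0 c,
      mul_zero]] at h3
    exact (mul_eq_zero.mp h3).resolve_left fun h' => hr (by linarith)
  · funext c
    rw [Matrix.sub_mulVec, Matrix.smul_mulVec, Matrix.one_mulVec]
    simp only [Pi.sub_apply, Pi.smul_apply, smul_eq_mul, Pi.zero_apply, Matrix.mulVec, dotProduct,
      Matrix.of_apply]
    have h4 : ∑ y with κ y = c, (r + 1) * f y = ∑ y with κ y = c,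
        (fun c => ∑ d, m c d * ∑ y with κ y = d, f y) (κ y) :=
      Finset.sum_congr rfl fun y _ => h2 y
    rw [sum_class_comp κ (fun c => ∑ d, m c d * ∑ y with κ y = d, f y), ← Finset.mul_sum] at h4
    rw [h4, Finset.mul_sum, sub_eq_zero]
    exact Finset.sum_congr rfl fun d _ => mul_assoc _ _ _

lemma classSize_of_twoCliqueDist {a b : ℕ} (ha : 2 ≤ a) (hb : 1 ≤ b)
    (hcard : Fintype.card W = a + b + 1)
    (hone : (blockMatrix κ twoCliqueDist).charpoly.roots.count (-1) = a - 1)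
    (hsq : ∑ x, ∑ y, blockMatrix κ twoCliqueDist x y ^ 2 =
      (1 + a + b : ℝ) ^ 2 - (1 + a + b) + 3 * (2 * a * b + b ^ 2 - b))
    {r : ℝ} (hr : 0 < r) (hr0 : pendantCubic a b r = 0)
    (hrc : 1 ≤ (blockMatrix κ twoCliqueDist).charpoly.roots.count r) :
    b = 1 ∧ classSize κ 0 = 1 ∧
      (classSize κ 1 = a ∧ classSize κ 2 = 1 ∨ classSize κ 1 = 1 ∧ classSize κ 2 = a) := by
  have h1 := twoCliqueDist_count_neg_one κ
  have h3 := card_eq_sum_classSize κ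
  rw [Fin.sum_univ_three, hcard] at h3
  rw [hone] at h1
  rw [sum_sq_twoCliqueDist] at hsq
  have hdet := det_eq_zero_of_mem_roots (κ := κ) (m := twoCliqueDist)
    (by intro c; fin_cases c <;> rfl) (by linarith) hrc
  rw [Matrix.det_fin_three] at hdet
  simp [twoCliqueDist] at hdet
  generalize classSize κ 0 = s at *
  generalize classSize κ 1 = p at *
  generalize classSize κ 2 = q at *
  obtain rfl : b = 1 := by omega
  have h4 : (a : ℝ) + 2 = s + p + q := by
    have : a + 2 = s + p + q := by omega
    exact_mod_cast this
  rw [show (s + p + q : ℝ) = 1 + a + 1 by linarith] at hsq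
  push_cast at hsq
  have h5 : (p : ℝ) * q = a := by linarith
  unfold pendantCubic at hr0
  push_cast at hr0
  have h6 : (s : ℝ) * (p * q) = a := by
    have e : (s : ℝ) = a + 2 - p - q := by linarith
    -- The multiplicity of -1 and the trace leave only b = 1, s + p + q = a + 2 and pq = a, which
    -- may have solutions with s ≠ 1. Subtracting the two cubics that vanish at r supplies the
    -- missing equation.
    have e2 : (s : ℝ) * (p * q) - a = (p * q - a) * (3 * (r + 1)) := by
      rw [e] at hdet ⊢
      linear_combination -hdet - hr0
    rw [h5, sub_self, zero_mul, sub_eq_zero] at e2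
    rw [h5, e2]
  have ha0 : (a : ℝ) ≠ 0 := by positivity
  have h7 : (s : ℝ) = 1 := by
    rw [h5] at h6
    exact mul_right_cancel₀ ha0 (by linarith)
  have h8 : s = 1 := by exact_mod_cast h7
  have h9 : ((p : ℤ) - 1) * (q - 1) = 0 := by
    have : ((p : ℝ) - 1) * (q - 1) = 0 := by linarith
    exact_mod_cast this
  refine ⟨rfl, h8, ?_⟩
  rcases mul_eq_zero.mp h9 with h | h <;> omega

end SplitNumerics

/-! ### Isomorphisms from block data, and universal vertices -/

namespace SimpleGraph

section Iso

variable {W V ι : Type*} [Fintype W] [DecidableEq W] [Fintype V] [DecidableEq V]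
  [DecidableEq ι]

lemma exists_equiv_of_classSize_eq {W V ι : Type*} [Fintype W] [Fintype V] [DecidableEq ι]
    {κ : W → ι} {κ' : V → ι} (h : ∀ c, classSize κ c = classSize κ' c) :
    ∃ e : W ≃ V, ∀ x, κ' (e x) = κ x := by
  refine ⟨(Equiv.sigmaFiberEquiv κ).symm.trans ((Equiv.sigmaCongrRight fun c =>
    Fintype.equivOfCardEq (h c)).trans (Equiv.sigmaFiberEquiv κ')), fun x => ?_⟩
  exact (Fintype.equivOfCardEq (h (κ x)) ⟨x, rfl⟩).2

lemma nonempty_iso_of_blockMatrix {G : SimpleGraph W} {H : SimpleGraph V} {κ : W → ι}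
    {κ' : V → ι} {m : ι → ι → ℝ} (hG : G.distanceMatrix = blockMatrix κ m)
    (hH : H.distanceMatrix = blockMatrix κ' m) (h : ∀ c, classSize κ c = classSize κ' c) :
    Nonempty (G ≃g H) := by
  obtain ⟨e, he⟩ := exists_equiv_of_classSize_eq h
  refine ⟨⟨e, fun {x y} => ?_⟩⟩
  have h1 : H.distanceMatrix (e x) (e y) = G.distanceMatrix x y := by
    rw [hG, hH]
    simp [blockMatrix, he]
  simp only [distanceMatrix, Matrix.of_apply, Nat.cast_inj] at h1
  rw [← dist_eq_one_iff_adj, ← dist_eq_one_iff_adj, h1]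

end Iso

section Universal

variable {W : Type*} {G : SimpleGraph W}

/-- A vertex adjacent to all other vertices. -/
def IsUniversalVertex (G : SimpleGraph W) (u : W) : Prop := ∀ v, v ≠ u → G.Adj u v

lemma IsUniversalVertex.dist_eq_two {u x y : W} (hu : G.IsUniversalVertex u) (hxy : x ≠ y)
    (hadj : ¬ G.Adj x y) : G.dist x y = 2 := by
  have hx : x ≠ u := by
    rintro rfl
    exact hadj (hu y hxy.symm)
  have hy : y ≠ u := by
    rintro rfl
    exact hadj (hu x hxy).symm
  have h1 := dist_le (Walk.cons (hu x hx).symm (Walk.cons (hu y hy) Walk.nil))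
  have h2 := ((hu x hx).symm.reachable.trans (hu y hy).reachable).one_lt_dist_of_ne_of_not_adj
    hxy hadj
  simp at h1
  omega

lemma IsUniversalVertex.distanceMatrix_eq [DecidableEq W] {ι : Type*} {u : W}
    (hu : G.IsUniversalVertex u) {κ : W → ι} {m : ι → ι → ℝ}
    (h : ∀ x y, x ≠ y → (G.Adj x y → m (κ x) (κ y) = 1) ∧ (¬ G.Adj x y → m (κ x) (κ y) = 2)) :
    G.distanceMatrix = blockMatrix κ m := by
  ext x y
  simp only [distanceMatrix, blockMatrix, Matrix.of_apply]
  split_ifs with hxy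
  · rw [hxy, dist_self, Nat.cast_zero]
  · by_cases hadj : G.Adj x y
    · rw [(h x y hxy).1 hadj, dist_eq_one_iff_adj.mpr hadj, Nat.cast_one]
    · rw [(h x y hxy).2 hadj, hu.dist_eq_two hxy hadj, Nat.cast_ofNat]

end Universal

end SimpleGraph

/-! ### Structure of G: universal vertex or geodesic path -/

namespace SimpleGraph

section Existence

variable {W : Type*} [Fintype W] [DecidableEq W] {G : SimpleGraph W}

/-- Either there is a universal vertex or a geodesic path of length three. -/
lemma exists_isUniversalVertex_or_isGeodesicFour (hG : G.Connected)
    (hI : HasPendantInertia G.distanceMatrix) :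
    (∃ u, G.IsUniversalVertex u) ∨ ∃ p : Fin 4 → W, IsGeodesicFour G (p 0) (p 1) (p 2) (p 3) := by
  classical
  have := hG.nonempty
  obtain ⟨v, hv⟩ := G.exists_maximal_degree_vertex
  by_cases hu : G.IsUniversalVertex v
  · exact Or.inl ⟨v, hu⟩
  right
  obtain ⟨w', hw', hvw'⟩ : ∃ w, w ≠ v ∧ ¬ G.Adj v w := by
    simpa [IsUniversalVertex] using hu
  obtain ⟨w, hvw⟩ := hG.exists_dist_eq (x := v) (y := w') (k := 2)
    (hG.one_lt_dist_of_ne_of_not_adj hw'.symm hvw')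
  obtain ⟨x, hvx, hxw⟩ := hG.exists_dist_eq_and_adj hvw
  have hvx' : G.Adj v x := dist_eq_one_iff_adj.mp hvx
  have hxw' : G.Adj x w := dist_eq_one_iff_adj.mp hxw
  -- Otherwise x would be adjacent to v, to all other neighbours of v and also to w, contradicting
  -- the maximality of the degree of v.
  obtain ⟨t, htx, hvt, hxt⟩ : ∃ t, t ≠ x ∧ G.Adj v t ∧ ¬ G.Adj x t := by
    by_contra! hcon
    have hsub : (G.neighborFinset v).erase x ⊂ (G.neighborFinset x).erase v := by
      refine Finset.ssubset_iff.mpr ⟨w, ?_, ?_⟩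
      · intro hmem
        have := dist_eq_one_iff_adj.mpr ((mem_neighborFinset _ _ _).mp (Finset.mem_of_mem_erase hmem))
        omega
      · intro t ht
        rcases Finset.mem_insert.mp ht with rfl | ht
        · refine Finset.mem_erase.mpr ⟨?_, (mem_neighborFinset _ _ _).mpr hxw'⟩
          rintro rfl
          simp at hvw
        · rw [Finset.mem_erase, mem_neighborFinset] at ht
          exact Finset.mem_erase.mpr ⟨ht.2.ne', (mem_neighborFinset _ _ _).mpr (hcon t ht.1 ht.2)⟩
    have hlt := Finset.card_lt_card hsub
    rw [Finset.card_erase_of_mem ((mem_neighborFinset _ _ _).mpr hvx'),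
      Finset.card_erase_of_mem ((mem_neighborFinset _ _ _).mpr hvx'.symm), card_neighborFinset_eq_degree,
      card_neighborFinset_eq_degree, ← hv] at hlt
    have := G.degree_le_maxDegree x
    omega
  have htv1 : G.dist t v = 1 := dist_eq_one_iff_adj.mpr hvt.symm
  have hxt2 : G.dist t x = 2 := by
    have h1 := hG.one_lt_dist_of_ne_of_not_adj htx fun h => hxt h.symm
    have h2 := hG.dist_triangle (u := t) (v := v) (w := x)
    omega
  have htw3 : G.dist t w ≤ 3 := by
    have h2 := hG.dist_triangle (u := t) (v := v) (w := w)
    omega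
  have htw0 : t ≠ w := by
    rintro rfl
    exact hxt hxw'
  have htw0' := hG.pos_dist_of_ne htw0
  obtain h1 | h2 | h3 : G.dist t w = 1 ∨ G.dist t w = 2 ∨ G.dist t w = 3 := by omega
  · exact (no_fourCycle hG hI htv1 hxt2 h1 hvx hvw hxw).elim
  · obtain ⟨m, htm, hmw⟩ := hG.exists_dist_eq_and_adj h2
    have hmv0 : v ≠ m := by
      rintro rfl
      omega
    have hmx0 : x ≠ m := by
      rintro rfl
      omega
    have hwv0 : w ≠ v := by
      rintro rfl
      simp at hvw
    have hwm0 : w ≠ m := by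
      rintro rfl
      simp at hmw
    have hvm := hG.dist_triangle (u := v) (v := t) (w := m)
    have hxm := hG.dist_triangle (u := x) (v := w) (w := m)
    rw [G.dist_comm (u := v) (v := t)] at hvm
    rw [G.dist_comm (u := w) (v := m)] at hxm
    have p1 := hG.pos_dist_of_ne hmv0
    have p2 := hG.pos_dist_of_ne hmx0
    -- The common neighbour m of t and w is a twin of v, a twin of t, or closes a 4-cycle t, v, x, m
    -- or a 5-cycle t, v, x, w, m. A twin would be at distance 2 from w.
    by_cases c1 : G.dist v m = 1 <;> by_cases c2 : G.dist x m = 1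
    · have := dist_eq_of_trueTwin_mid hG hI htv1 hxt2 hvx htm c1 c2 hwv0 hwm0
      omega
    · have := dist_eq_of_trueTwin_end hG hI htv1 hxt2 hvx htm c1 (by omega) htw0.symm hwm0
      omega
    · exact (no_fourCycle hG hI htv1 hxt2 htm hvx (by omega) c2).elim
    · exact (no_fiveCycle hG hI htv1 hxt2 h2 htm hvx hvw (by omega) hxw (by omega)
        (by rw [G.dist_comm]; exact hmw)).elim
  · exact ⟨![t, v, x, w], htv1, hxt2, h3, hvx, hvw, hxw⟩

/-- If x and z were not adjacent, y would be a true twin of u as the middle of the path x, y, z, and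
so universal itself. -/
lemma IsUniversalVertex.adj_trans (hG : G.Connected) (hI : HasPendantInertia G.distanceMatrix)
    {u x y z : W} (hu : G.IsUniversalVertex u) (hy : ¬ G.IsUniversalVertex y) (hxy : G.Adj x y)
    (hyz : G.Adj y z) (hxz : x ≠ z) : G.Adj x z := by
  by_contra hadj
  have hux : x ≠ u := by
    rintro rfl
    exact hadj (hu z hxz.symm)
  have huz : z ≠ u := by
    rintro rfl
    exact hadj (hu x hxz).symm
  have huy : y ≠ u := by
    rintro rfl
    exact hy hu
  apply hy
  intro v hv
  by_cases hvu : v = u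
  · rw [hvu]
    exact (hu y huy).symm
  · have := dist_eq_of_trueTwin_mid hG hI (dist_eq_one_iff_adj.mpr hxy) (hu.dist_eq_two hxz hadj)
      (dist_eq_one_iff_adj.mpr hyz) (dist_eq_one_iff_adj.mpr (hu x hux).symm)
      (dist_eq_one_iff_adj.mpr (hu y huy).symm) (dist_eq_one_iff_adj.mpr (hu z huz).symm) hv hvu
    rw [dist_eq_one_iff_adj.mpr (hu v hvu)] at this
    exact dist_eq_one_iff_adj.mp this.symm

/-- By `adj_trans` the non-universal vertices split into cliques. If two of these contain an edge, a
third clique is impossible by `no_two_edges_and_vertex`. `P` is a clique that contains an edge, or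
empty if there is none. -/
lemma IsUniversalVertex.exists_partition (hG : G.Connected)
    (hI : HasPendantInertia G.distanceMatrix) {u : W} (hu : G.IsUniversalVertex u) :
    ∃ P : W → Prop,
      (∀ x y, ¬ G.IsUniversalVertex x → ¬ G.IsUniversalVertex y → x ≠ y → P x → P y → G.Adj x y) ∧
      (∀ x y, ¬ G.IsUniversalVertex x → ¬ G.IsUniversalVertex y → P x → ¬ P y → ¬ G.Adj x y) ∧
      ((∀ x y, ¬ G.IsUniversalVertex x → ¬ G.IsUniversalVertex y → ¬ P x → ¬ P y →
        ¬ G.Adj x y) ∨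
      (∀ x y, ¬ G.IsUniversalVertex x → ¬ G.IsUniversalVertex y → x ≠ y → ¬ P x → ¬ P y →
        G.Adj x y)) := by
  have htr := fun {x y z : W} => hu.adj_trans hG hI (x := x) (y := y) (z := z)
  by_cases hedge : ∃ x y, ¬ G.IsUniversalVertex x ∧ ¬ G.IsUniversalVertex y ∧ G.Adj x y
  · obtain ⟨x₀, y₀, hx₀, hy₀, hxy₀⟩ := hedge
    have hcross : ∀ x y, ¬ G.IsUniversalVertex x → (x = x₀ ∨ G.Adj x₀ x) →
        ¬ (y = x₀ ∨ G.Adj x₀ y) → ¬ G.Adj x y := by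
      rintro x y hx (rfl | hx') hy hxy
      · exact hy (Or.inr hxy)
      · by_cases h : y = x₀
        · exact hy (Or.inl h)
        · exact hy (Or.inr (htr hx hx' hxy fun h' => h h'.symm))
    refine ⟨fun x => x = x₀ ∨ G.Adj x₀ x, ?_, fun x y hx _ => hcross x y hx, ?_⟩
    · rintro x y hx hy hxy (rfl | hx') (rfl | hy')
      · exact absurd rfl hxy
      · exact hy'
      · exact hx'.symm
      · exact htr hx₀ hx'.symm hy' hxy
    · by_cases hedge' : ∃ z t, (¬ G.IsUniversalVertex z ∧ ¬ G.IsUniversalVertex t) ∧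
          (¬ (z = x₀ ∨ G.Adj x₀ z) ∧ ¬ (t = x₀ ∨ G.Adj x₀ t)) ∧ G.Adj z t
      · right
        obtain ⟨z, t, ⟨hz, ht⟩, ⟨hPz, hPt⟩, hzt⟩ := hedge'
        have hx₀2 : ∀ y, ¬ (y = x₀ ∨ G.Adj x₀ y) → G.dist x₀ y = 2 := fun y hy =>
          hu.dist_eq_two (fun h => hy (Or.inl h.symm)) (fun h => hy (Or.inr h))
        have hy₀2 : ∀ y, ¬ (y = x₀ ∨ G.Adj x₀ y) → G.dist y₀ y = 2 := fun y hy =>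
          hu.dist_eq_two (fun h => hy (Or.inr (h ▸ hxy₀))) (hcross _ _ hy₀ (Or.inr hxy₀) hy)
        have hz' : ∀ w, ¬ G.IsUniversalVertex w → ¬ (w = x₀ ∨ G.Adj x₀ w) → w = z ∨ G.Adj z w := by
          intro w hw hPw
          by_contra! hcon
          have htw : ¬ G.Adj t w := fun h => hcon.2 (htr ht hzt h hcon.1.symm)
          have htw' : t ≠ w := by
            rintro rfl
            exact hcon.2 hzt
          exact no_two_edges_and_vertex hG hI (dist_eq_one_iff_adj.mpr hxy₀) (hx₀2 z hPz)
            (hx₀2 t hPt) (hx₀2 w hPw) (hy₀2 z hPz) (hy₀2 t hPt) (hy₀2 w hPw)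
            (dist_eq_one_iff_adj.mpr hzt) (hu.dist_eq_two hcon.1.symm hcon.2)
            (hu.dist_eq_two htw' htw)
        intro x y hx hy hxy hPx hPy
        rcases hz' x hx hPx with rfl | hx' <;> rcases hz' y hy hPy with rfl | hy'
        · exact absurd rfl hxy
        · exact hy'
        · exact hx'.symm
        · exact htr hz hx'.symm hy' hxy
      · left
        intro x y hx hy hPx hPy hxy
        exact hedge' ⟨x, y, ⟨hx, hy⟩, ⟨hPx, hPy⟩, hxy⟩
  · refine ⟨fun _ => False, by simp, by simp, Or.inl ?_⟩
    intro x y hx hy _ _ hxy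
    exact hedge ⟨x, y, hx, hy, hxy⟩

lemma IsUniversalVertex.exists_blocks (hG : G.Connected)
    (hI : HasPendantInertia G.distanceMatrix) {u : W} (hu : G.IsUniversalVertex u) :
    ∃ κ : W → Fin 3, G.distanceMatrix = blockMatrix κ splitDist ∨
      G.distanceMatrix = blockMatrix κ twoCliqueDist := by
  classical
  obtain ⟨P, h1, h2, h3⟩ := hu.exists_partition hG hI
  refine ⟨fun x => if G.IsUniversalVertex x then 0 else if P x then 1 else 2, ?_⟩
  refine h3.imp (fun h3 => hu.distanceMatrix_eq fun x y hxy => ?_)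
    (fun h3 => hu.distanceMatrix_eq fun x y hxy => ?_)
  all_goals
    by_cases hx : G.IsUniversalVertex x
    · have h4 := hx y hxy.symm
      by_cases hy : G.IsUniversalVertex y <;> by_cases hPy : P y <;>
        simp [hx, hy, h4, hPy, splitDist, twoCliqueDist]
    by_cases hy : G.IsUniversalVertex y
    · have h4 := (hy x hxy).symm
      by_cases hPx : P x <;> simp [hx, hy, h4, hPx, splitDist, twoCliqueDist]
    have h1' := h1 x y hx hy hxy
    have h2' := h2 x y hx hy
    have h2'' := h2 y x hy hx
    rw [G.adj_comm] at h2''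
    have h3' := h3 x y hx hy
    by_cases hPx : P x <;> by_cases hPy : P y <;> simp_all [splitDist, twoCliqueDist]

end Existence

/-! ### Block form of K_n^h and comparison of the two patterns -/

/-- The class of a vertex of `cliqueWithPendants n h`. -/
def pendantClass (n h : ℕ) (i : Fin n) : Fin 3 :=
  if i.val = 0 then 0 else if i.val < h then 1 else 2

lemma distanceMatrix_cliqueWithPendants {n h : ℕ} (hh : 1 ≤ h) (hn : 1 ≤ n) :
    (cliqueWithPendants n h).distanceMatrix = blockMatrix (pendantClass n h) splitDist := by
  have hu : (cliqueWithPendants n h).IsUniversalVertex ⟨0, hn⟩ := by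
    intro v hv
    refine ⟨hv.symm, ?_⟩
    by_cases hvh : v.val < h
    · exact Or.inl ⟨hh, hvh⟩
    · exact Or.inr (Or.inl ⟨rfl, by omega⟩)
  refine hu.distanceMatrix_eq fun x y hxy => ?_
  have hxy' : x.val ≠ y.val := fun h => hxy (Fin.ext h)
  simp only [cliqueWithPendants, pendantClass, ne_eq, hxy, not_false_eq_true, true_and]
  by_cases hx0 : x.val = 0 <;> by_cases hy0 : y.val = 0 <;> by_cases hxh : x.val < h <;>
    by_cases hyh : y.val < h <;> simp [*, splitDist] <;> omega

lemma classSize_pendantClass {n h : ℕ} (hh : 1 ≤ h) (hn : h ≤ n) :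
    classSize (pendantClass n h) 0 = 1 ∧ classSize (pendantClass n h) 1 = h - 1 ∧
      classSize (pendantClass n h) 2 = n - h := by
  have h0 : classSize (pendantClass n h) 0 = 1 := by
    refine Fintype.card_eq_one_iff.mpr ⟨⟨⟨0, by omega⟩, by simp [pendantClass]⟩, ?_⟩
    rintro ⟨i, hi⟩
    ext
    simp only [pendantClass] at hi
    split_ifs at hi with h1 h2
    · exact h1
    all_goals simp at hi
  have h2 : classSize (pendantClass n h) 2 = n - h := by
    have hle : ∀ i, pendantClass n h i = 2 → h ≤ i.val := by
      intro i hi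
      by_contra hlt
      simp only [pendantClass] at hi
      split_ifs at hi <;> omega
    have e : {i : Fin n // pendantClass n h i = 2} ≃ Fin (n - h) :=
      { toFun := fun i => ⟨i.1.val - h, by have := hle i.1 i.2; omega⟩
        invFun := fun j => ⟨⟨j.val + h, by omega⟩, by
          simp only [pendantClass]
          rw [if_neg (by omega), if_neg (by omega)]⟩
        left_inv := by
          rintro ⟨i, hi⟩
          ext
          simp [hle i hi]
        right_inv := by
          rintro j
          ext
          simp }
    rw [classSize, Fintype.card_congr e, Fintype.card_fin]
  have h3 := card_eq_sum_classSize (pendantClass n h)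
  rw [Fin.sum_univ_three, Fintype.card_fin, h0, h2] at h3
  exact ⟨h0, by omega, h2⟩

end SimpleGraph

open SimpleGraph

section Swap

variable {W : Type*} [DecidableEq W] (κ : W → Fin 3)

/-- The two patterns differ only in the last diagonal entry, which is not used when that class has
at most one element. -/
lemma blockMatrix_twoCliqueDist_eq_splitDist (h : ∀ x y, κ x = 2 → κ y = 2 → x = y) :
    blockMatrix κ twoCliqueDist = blockMatrix κ splitDist := by
  ext x y
  simp only [blockMatrix, Matrix.of_apply]
  split_ifs with hxy
  · rfl
  · have := fun hx hy => hxy (h x y hx hy)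
    generalize κ x = i at *
    generalize κ y = j at *
    fin_cases i <;> fin_cases j <;> simp [twoCliqueDist, splitDist] at this ⊢

lemma blockMatrix_twoCliqueDist_swap :
    blockMatrix (fun x => Equiv.swap 1 2 (κ x)) twoCliqueDist = blockMatrix κ twoCliqueDist := by
  ext x y
  simp only [blockMatrix, Matrix.of_apply]
  split_ifs with hxy
  · rfl
  · generalize κ x = i
    generalize κ y = j
    fin_cases i <;> fin_cases j <;> simp [twoCliqueDist, Equiv.swap_apply_def]

lemma classSize_swap {W : Type*} [Fintype W] (κ : W → Fin 3) (c : Fin 3) :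
    classSize (fun x => Equiv.swap 1 2 (κ x)) c = classSize κ (Equiv.swap 1 2 c) := by
  refine Fintype.card_congr (Equiv.subtypeEquivRight fun x => ?_)
  rw [Equiv.swap_apply_eq_iff]

end Swap

theorem theorem3p3 (n h : ℕ) (h3 : 3 ≤ h) (hn : h + 1 ≤ n) :
    SimpleGraph.IsDeterminedByDistanceSpectrum.{0, v} (SimpleGraph.cliqueWithPendants n h) := by
  intro W _ _ H hH hspec
  unfold distanceSpectrum at hspec
  obtain ⟨a, rfl⟩ : ∃ a, h = a + 1 := ⟨h - 1, by omega⟩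
  obtain ⟨b, rfl⟩ : ∃ b, n = a + b + 1 := ⟨n - (a + 1), by omega⟩
  have ha : 2 ≤ a := by omega
  have hb : 1 ≤ b := by omega
  have hK := distanceMatrix_cliqueWithPendants (n := a + b + 1) (h := a + 1) (by omega) (by omega)
  obtain ⟨s0, s1, s2⟩ := classSize_pendantClass (n := a + b + 1) (h := a + 1) (by omega) (by omega)
  rw [show a + 1 - 1 = a by omega] at s1
  rw [show a + b + 1 - (a + 1) = b by omega] at s2
  obtain ⟨r₁, r₂, r₃, q₁, q₂, q₂', q₃, hr₁, hroots⟩ :=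
    roots_charpoly_pendant (pendantClass (a + b + 1) (a + 1)) ha hb s0 s1 s2
  rw [← hK] at hroots
  have hsymm := distanceMatrix_isSymm H
  have hsq := sum_sq_eq_sum_roots hsymm
  rw [hspec, ← sum_sq_eq_sum_roots (distanceMatrix_isSymm _), hK, sum_sq_splitDist, s0, s1, s2,
    Nat.cast_one] at hsq
  rw [hroots] at hspec
  have hI := hasPendantInertia_of_roots hsymm q₁ q₂ q₂' q₃ hspec
  -- The order of `H` is part of the spectral data: the characteristic polynomial of a real
  -- symmetric matrix splits, so its roots count the vertices.
  have hcard : Fintype.card W = a + b + 1 := by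
    have h1 := Polynomial.splits_iff_card_roots.mp
      (show H.distanceMatrix.IsHermitian from by
        rw [Matrix.IsHermitian, Matrix.conjTranspose_eq_transpose_of_trivial]
        exact hsymm).splits_charpoly
    rw [Matrix.charpoly_natDegree_eq_dim, hspec] at h1
    simp at h1
    omega
  have hone : H.distanceMatrix.charpoly.roots.count (-1) = a - 1 := by
    rw [hspec]
    simp [Multiset.count_replicate,
      show -1 ≠ r₁ by linarith, show -1 ≠ r₂ by linarith, show -1 ≠ r₃ by linarith]
  have htwo : H.distanceMatrix.charpoly.roots.count (-2) = b - 1 := by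
    rw [hspec]
    simp [Multiset.count_replicate,
      show -2 ≠ r₁ by linarith, show -2 ≠ r₂ by linarith, show -2 ≠ r₃ by linarith]
  have hrc : 1 ≤ H.distanceMatrix.charpoly.roots.count r₁ := by
    rw [hspec, Multiset.one_le_count_iff_mem]
    simp
  have key : ∀ κ : W → Fin 3, H.distanceMatrix = blockMatrix κ splitDist →
      Nonempty (H ≃g cliqueWithPendants (a + b + 1) (a + 1)) := by
    intro κ hκ
    rw [hκ] at hone htwo hsq
    obtain ⟨t0, t1, t2⟩ := classSize_of_splitDist ha hb hcard hone htwo hsq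
    refine nonempty_iso_of_blockMatrix hκ hK fun c => ?_
    fin_cases c
    exacts [t0.trans s0.symm, t1.trans s1.symm, t2.trans s2.symm]
  have key' : ∀ κ : W → Fin 3, H.distanceMatrix = blockMatrix κ twoCliqueDist →
      classSize κ 2 = 1 → Nonempty (H ≃g cliqueWithPendants (a + b + 1) (a + 1)) := by
    intro κ hκ h2
    refine key κ (hκ.trans (blockMatrix_twoCliqueDist_eq_splitDist κ fun x y hx hy => ?_))
    have := Fintype.card_le_one_iff.mp h2.le ⟨x, hx⟩ ⟨y, hy⟩
    exact Subtype.ext_iff.mp this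
  rcases exists_isUniversalVertex_or_isGeodesicFour hH hI with ⟨u, hu⟩ | ⟨p, hp⟩
  · obtain ⟨κ, hκ | hκ⟩ := hu.exists_blocks hH hI
    · exact key κ hκ
    · have hκ' := hκ
      rw [hκ] at hone hsq hrc
      obtain ⟨-, -, h' | h'⟩ := classSize_of_twoCliqueDist ha hb hcard hone hsq q₁ hr₁ hrc
      · exact key' κ hκ h'.2
      -- The singleton clique is class 1 here; the pattern is symmetric in classes 1 and 2, so they
      -- are interchanged.
      · refine key' _ (hκ.trans (blockMatrix_twoCliqueDist_swap κ).symm) ?_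
        rw [classSize_swap, Equiv.swap_apply_right, h'.1]
  · obtain ⟨κ, e, f, hκ, hD, he, hf⟩ := exists_pathDist_blocks hH hI hp
    rw [hD] at hI hone hsq
    exact (blockMatrix_pathDist_false hκ he hf hI ha hb hcard hone hsq).elim
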